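/- **Setting.** Consider $n$ qudits of local dimension $q$, the computational basis of each being labelled by a finite abelian group $G$ with $|G|=q$ (usually $G=\mathbb Z_q$, or the additive group of $\mathbb F_q$). The Pauli group consists of the operators $c\,P_1\otimes\cdots\otimes P_n$ with $|c|=1$ and each $P_i$ of the form $|y\rangle\mapsto\chi_i(y)\,|y+a_i\rangle$, where $a_i\in G$ and $\chi_i$ is a character of $G$. A stabilizer code is the simultaneous $+1$ eigenspace of all elements of an abelian subgroup of the Pauli group; $\Pi_c$ denotes the orthogonal projector onto it. Let $A$ be a set of qudits, $\bar A$ its complement, and $\mathcal H=\mathcal H_A\otimes\mathcal H_{\bar A}$ the corresponding bipartition. **Area operators.** Let $\Pi$ be the orthogonal projector onto a code $\mathcal C\subseteq\mathcal H$. Let $M_A$ be the algebra of operators $X$ on $\mathcal C$ for which some $O$ on $\mathcal H_A$ satisfies $(O\otimes 1)|\psi\rangle=X|\psi\rangle$ and $(O^\dagger\otimes 1)|\psi\rangle=X^\dagger|\psi\rangle$ for all $|\psi\rangle\in\mathcal C$; define $M_{\bar A}$ likewise. A complementary recovery of $\mathcal C$ for $A,\bar A$ consists of finitely many sectors $\alpha$,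 isometries $$W_A:\bigoplus_\alpha\mathcal H_{A_1^\alpha}\otimes\mathcal H_{A_2^\alpha}\to\mathcal H_A,\qquad W_{\bar A}:\bigoplus_\alpha\mathcal H_{\bar A_1^\alpha}\otimes\mathcal H_{\bar A_2^\alpha}\to\mathcal H_{\bar A}$$ and unit vectors $|\chi_\alpha\rangle\in\mathcal H_{A_2^\alpha}\otimes\mathcal H_{\bar A_2^\alpha}$ such that the vectors $$|\widetilde{\alpha,ij}\rangle=(W_A\otimes W_{\bar A})\,|\alpha,i\rangle_{A_1^\alpha}|\alpha,j\rangle_{\bar A_1^\alpha}|\chi_\alpha\rangle_{A_2^\alpha\bar A_2^\alpha}$$ form an orthonormal basis of $\mathcal C$ (where $i$ and $j$ run over orthonormal bases of the nonzero spaces $\mathcal H_{A_1^\alpha}$, $\mathcal H_{\bar A_1^\alpha}$), in which $M_A$ is exactly the set of operators $\bigoplus_\alpha O_\alpha\otimes 1$ and $M_{\bar A}$ is exactly the set of operators $\bigoplus_\alpha 1\otimes O_\alpha$. Its area operator is $$\mathcal L_A=\sum_\alpha S\big(\mathrm{Tr}_{\bar A_2^\alpha}|\chi_\alpha\rangle\langle\chi_\alpha|\big)\sum_{i,j}|\widetilde{\alpha,ij}\rangle\langle\widetilde{\alpha,ij}|,$$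 where $S$ is the von Neumann entropy. An area operator of $\mathcal C$ for $A,\bar A$ is the area operator of some complementary recovery of $\mathcal C$ for $A,\bar A$. **Proposition.** Let $\Pi=Q\,\Pi_c\,Q^\dagger$, where $\Pi_c$ is the projector of a stabilizer code and $Q=Q_A\otimes Q_{\bar A}$ with $Q_A$, $Q_{\bar A}$ unitary on $\mathcal H_A$, $\mathcal H_{\bar A}$. Then the code with projector $\Pi$ has a trivial area operator for the bipartition $A,\bar A$: it has an area operator, and every area operator $\mathcal L_A$ of it is a real multiple of the logical identity, $\mathcal L_A=s\,\Pi$ with $s\in\mathbb R$. -/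

import Mathlib

open scoped Kronecker Matrix

noncomputable section

namespace AreaLaw

/-! ### Pauli operators and stabilizer codes on `n` qudits

A qudit has computational basis labelled by a finite abelian group `G`, so its local dimension is
`q = |G|`. For `G = ZMod q` the operators below are the usual generalized Pauli (Heisenberg-Weyl)
operators `X ^ a * Z ^ b`; for `G` the additive group of a finite field they are the Pauli operators
of Galois qudits. -/

section Stabilizer

variable {G : Type*} [AddCommGroup G] [Fintype G] [DecidableEq G] {n : ℕ}

/-- The one-qudit Pauli operator `|y⟩ ↦ χ(y) |y + a⟩`, for a shift `a` and a character `χ`. -/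
def pauliSite (a : G) (χ : AddChar G ℂ) : Matrix G G ℂ :=
  Matrix.of fun x y => if x = y + a then χ y else 0

/-- Membership in the `n`-qudit Pauli group: a phase times a tensor product of one-qudit Pauli
operators. -/
def IsPauli (P : Matrix (Fin n → G) (Fin n → G) ℂ) : Prop :=
  ∃ (c : ℂ) (a : Fin n → G) (χ : Fin n → AddChar G ℂ), ‖c‖ = 1 ∧
    P = Matrix.of fun x y => c * ∏ i, pauliSite (a i) (χ i) (x i) (y i)

/-- `Pc` is the code projector of a stabilizer code: for some abelian subgroup `S` of the Pauli
group, `Pc` is the orthogonal projector onto the simultaneous `+1` eigenspace of all elements of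
`S`. -/
def IsStabilizerProjector (Pc : Matrix (Fin n → G) (Fin n → G) ℂ) : Prop :=
  ∃ S : Subgroup (Matrix.unitaryGroup (Fin n → G) ℂ),
    (∀ U ∈ S, IsPauli U.1) ∧
    (∀ U ∈ S, ∀ U' ∈ S, U * U' = U' * U) ∧
    Pc.IsHermitian ∧ Pc * Pc = Pc ∧
    ∀ v : (Fin n → G) → ℂ, Pc.mulVec v = v ↔ ∀ U ∈ S, U.1.mulVec v = v

/-- The identification of operators on the `n`-qudit space with operators on `H_A ⊗ H_Ā`, where
`A` is a set of qudits and `Ā` its complement. -/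
def bipartite (A : Finset (Fin n)) :
    Matrix (Fin n → G) (Fin n → G) ℂ ≃
      Matrix (({i // i ∈ A} → G) × ({i // i ∉ A} → G))
        (({i // i ∈ A} → G) × ({i // i ∉ A} → G)) ℂ :=
  Matrix.reindex (Equiv.piEquivPiSubtypeProd (fun i => i ∈ A) (fun _ => G))
    (Equiv.piEquivPiSubtypeProd (fun i => i ∈ A) (fun _ => G))

end Stabilizer

/-! ### Entanglement entropy -/

section Entropy

/-- The von Neumann entropy `-Tr (ρ log ρ)` of a Hermitian matrix, through its eigenvalues. -/
def vonNeumannEntropy {a : Type*} [Fintype a] [DecidableEq a] (ρ : Matrix a a ℂ)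
    (hρ : ρ.IsHermitian) : ℝ :=
  ∑ i, Real.negMulLog (hρ.eigenvalues i)

/-- The reduced matrix `Tr_b |ψ⟩⟨ψ|` on the first factor of a vector `ψ` of `ℂ^a ⊗ ℂ^b`. -/
def reducedState {a b : Type*} [Fintype b] (ψ : a × b → ℂ) : Matrix a a ℂ :=
  Matrix.of fun k k' => ∑ l, ψ (k, l) * star (ψ (k', l))

theorem reducedState_isHermitian {a b : Type*} [Fintype b] (ψ : a × b → ℂ) :
    (reducedState ψ).IsHermitian := by
  ext k k'
  simp [reducedState, Matrix.conjTranspose_apply, mul_comm]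

end Entropy

/-! ### Code subalgebras, complementary recovery and the area operator

In this section `H_A = ℂ^a` and `H_Ā = ℂ^b`, and `P` is the code projector, an operator on
`H_A ⊗ H_Ā` with range the code `C`. Operators on `C` are regarded as operators on `H_A ⊗ H_Ā` that
vanish on the orthogonal complement of `C`; the logical identity is then `P`. -/

section Area

variable {a b : Type*} [Fintype a] [DecidableEq a] [Fintype b] [DecidableEq b]

/-- The code subalgebra `M_A`: the logical operators `X` that are supported on `A`, i.e.
some `O` on `H_A` acts on the code as `X` and its adjoint acts on the code as the adjoint
of `X`. -/
def codeSubalgebraA (P : Matrix (a × b) (a × b) ℂ) : Set (Matrix (a × b) (a × b) ℂ) :=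
  {X | ∃ O : Matrix a a ℂ,
    (O ⊗ₖ (1 : Matrix b b ℂ)) * P = X ∧ (Oᴴ ⊗ₖ (1 : Matrix b b ℂ)) * P = Xᴴ}

/-- The code subalgebra `M_Ā`: the logical operators that are supported on `Ā`. -/
def codeSubalgebraB (P : Matrix (a × b) (a × b) ℂ) : Set (Matrix (a × b) (a × b) ℂ) :=
  {X | ∃ O : Matrix b b ℂ,
    ((1 : Matrix a a ℂ) ⊗ₖ O) * P = X ∧ ((1 : Matrix a a ℂ) ⊗ₖ Oᴴ) * P = Xᴴ}

/-- The operator `|u⟩⟨v|`. -/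
def ketBra {c : Type*} (u v : c → ℂ) : Matrix c c ℂ := Matrix.vecMulVec u (star v)

/-- The codeword `(W_A ⊗ W_Ā) (|α,i⟩_{A₁} |α,j⟩_{Ā₁} |χ_α⟩_{A₂ Ā₂})`. -/
def codeword {Sector : Type} {A₁ B₁ A₂ B₂ : Sector → Type}
    [∀ α, Fintype (A₂ α)] [∀ α, Fintype (B₂ α)]
    (WA : Matrix a (Σ α, A₁ α × A₂ α) ℂ) (WB : Matrix b (Σ α, B₁ α × B₂ α) ℂ)
    (χ : ∀ α, A₂ α × B₂ α → ℂ) (α : Sector) (i : A₁ α) (j : B₁ α) : a × b → ℂ :=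
  fun x => ∑ k, ∑ l, WA x.1 ⟨α, i, k⟩ * WB x.2 ⟨α, j, l⟩ * χ α (k, l)

/-- The data of complementary recovery for the code with projector `P`.

The factor `H_A` contains `⨁_α H_{A₁^α} ⊗ H_{A₂^α}` through the isometry `WA` (the recovery unitary
`U_A` restricted to that sum; a remaining summand of `H_A` is allowed), likewise for `Ā`, and the
vectors `|α,ij⟩ = (W_A ⊗ W_Ā) (|α,i⟩ |α,j⟩ |χ_α⟩)`, which are orthonormal, form a basis of the code.
This basis gives the Wedderburn decomposition `C = ⨁_α H_{a^α} ⊗ H_{ā^α}` of the code induced by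
`M_A`, in which `M_A` consists of the operators `⨁_α O_α ⊗ 1` and its commutant, which consists of
the operators `⨁_α 1 ⊗ O_α`, is `M_Ā`. -/
structure ComplementaryRecovery (P : Matrix (a × b) (a × b) ℂ) where
  Sector : Type
  A₁ : Sector → Type
  B₁ : Sector → Type
  A₂ : Sector → Type
  B₂ : Sector → Type
  [fintypeSector : Fintype Sector]
  [fintypeA₁ : ∀ α, Fintype (A₁ α)]
  [fintypeB₁ : ∀ α, Fintype (B₁ α)]
  [fintypeA₂ : ∀ α, Fintype (A₂ α)]
  [fintypeB₂ : ∀ α, Fintype (B₂ α)]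
  [decEqSector : DecidableEq Sector]
  [decEqA₁ : ∀ α, DecidableEq (A₁ α)]
  [decEqB₁ : ∀ α, DecidableEq (B₁ α)]
  [decEqA₂ : ∀ α, DecidableEq (A₂ α)]
  [decEqB₂ : ∀ α, DecidableEq (B₂ α)]
  [nonemptyA₁ : ∀ α, Nonempty (A₁ α)]
  [nonemptyB₁ : ∀ α, Nonempty (B₁ α)]
  WA : Matrix a (Σ α, A₁ α × A₂ α) ℂ
  WB : Matrix b (Σ α, B₁ α × B₂ α) ℂ
  χ : ∀ α, A₂ α × B₂ α → ℂ
  isometryA : WAᴴ * WA = 1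
  isometryB : WBᴴ * WB = 1
  normalized : ∀ α, ∑ x, ‖χ α x‖ ^ 2 = 1
  basis : P = ∑ α, ∑ i, ∑ j, ketBra (codeword WA WB χ α i j) (codeword WA WB χ α i j)
  wedderburnA : ∀ X, X ∈ codeSubalgebraA P ↔ ∃ O : ∀ α, Matrix (A₁ α) (A₁ α) ℂ,
    X = ∑ α, ∑ i, ∑ i', ∑ j,
      O α i i' • ketBra (codeword WA WB χ α i j) (codeword WA WB χ α i' j)
  wedderburnB : ∀ X, X ∈ codeSubalgebraB P ↔ ∃ O : ∀ α, Matrix (B₁ α) (B₁ α) ℂ,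
    X = ∑ α, ∑ i, ∑ j, ∑ j',
      O α j j' • ketBra (codeword WA WB χ α i j) (codeword WA WB χ α i j')

attribute [instance] ComplementaryRecovery.fintypeSector ComplementaryRecovery.fintypeA₁
  ComplementaryRecovery.fintypeB₁ ComplementaryRecovery.fintypeA₂ ComplementaryRecovery.fintypeB₂
  ComplementaryRecovery.decEqSector ComplementaryRecovery.decEqA₁ ComplementaryRecovery.decEqB₁
  ComplementaryRecovery.decEqA₂ ComplementaryRecovery.decEqB₂
  ComplementaryRecovery.nonemptyA₁ ComplementaryRecovery.nonemptyB₁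

namespace ComplementaryRecovery

variable {P : Matrix (a × b) (a × b) ℂ} (D : ComplementaryRecovery P)

/-- The entropy `S(χ_α)` of the reduced state of `|χ_α⟩` on `A₂`. -/
def sectorEntropy (α : D.Sector) : ℝ :=
  vonNeumannEntropy (reducedState (D.χ α)) (reducedState_isHermitian (D.χ α))

/-- The logical identity of the block `α`. -/
def blockIdentity (α : D.Sector) : Matrix (a × b) (a × b) ℂ :=
  ∑ i, ∑ j, ketBra (codeword D.WA D.WB D.χ α i j) (codeword D.WA D.WB D.χ α i j)

/-- The area operator `⨁_α S(χ_α) 1_{a^α ā^α}`. -/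
def areaOperator : Matrix (a × b) (a × b) ℂ :=
  ∑ α, (D.sectorEntropy α : ℂ) • D.blockIdentity α

end ComplementaryRecovery

/-- `L` is an area operator of the code with projector `P` for the bipartition `A`, `Ā`. -/
def IsAreaOperator (P L : Matrix (a × b) (a × b) ℂ) : Prop :=
  ∃ D : ComplementaryRecovery P, L = D.areaOperator

/-- The code has a trivial area operator: it has an area operator, and every area operator of it is
a multiple of the logical identity. -/
def HasTrivialAreaOperator (P : Matrix (a × b) (a × b) ℂ) : Prop :=
  (∃ L, IsAreaOperator P L) ∧ ∀ L, IsAreaOperator P L → ∃ s : ℝ, L = (s : ℂ) • P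

end Area

end AreaLaw

end

/-!
Why the area operator of a stabilizer code is trivial, also after local unitaries.

*Weyl operators.* For the bipartition, the Pauli operators are phases times the Weyl operators of
the group `K × L`, where `K` and `L` are the groups of all labels on `A` and on `Ā`. They are
indexed by the phase space `(K × L) × AddChar (K × L) ℂ`, they are products `U_A ⊗ U_Ā`, and they
form an orthogonal basis of all operators. The stabilizers form an isotropic subgroup `S` of the phase
space, and the Weyl operators of points orthogonal to `S` are the logical ones. An operator that
commutes with a set of Weyl operators is a combination of Weyl operators commuting with that set
(`orth_of_trace_ne_zero`), and double annihilators of subgroups are computed by Pontryagin duality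
(`mem_of_orth_orth`). So the logical operators commuting with all logical Weyl operators orthogonal
to a subgroup `F` are spanned by those of `F` (`IsStabilizedBy.eq_sum_of_commute`). With `F` the
points supported on `Ā`, this says that the commutant of `M_A` on the code lies in `M_Ā`. With
`F = 0`, it says that only the scalars commute with all local symmetries of the code, the product
unitaries `U_A ⊗ U_Ā` that preserve it. Both properties (`IsLocallyHomogeneous`) survive conjugation
by the product unitary `Q`, and the rest of the argument uses only them.

*Existence.* `M_A` is a star-algebra of matrices, so it has a system of matrix units
(`exists_matrixUnits`), obtained from a maximal family of orthogonal projections in it. These units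
split the code into blocks with codewords `|α,ij⟩`. In each block the operators that change `i` lift
to `H_A`. Those that change `j` commute with `M_A`, so they lie in `M_Ā` and lift to `H_Ā`. Applying
the lifts to the two sides of the Schmidt decomposition of one codeword per block gives the
isometries `W_A` and `W_Ā` (`nonempty_complementaryRecovery`).

*Triviality.* For any complementary recovery, the block identities are the minimal projections of
`M_A ∩ M_Ā`, so a local symmetry permutes the blocks (`exists_blockIdentity_conj`). Blocks in one
orbit have factors of equal dimensions and unitarily equivalent reduced states `1 ⊗ ρ_α` on `A`,
hence the same traces of all positive powers of `ρ_α` and the same entropy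
(`sectorEntropy_eq_of_conj`). So the area operator commutes with all local symmetries, and is a
scalar; the scalar is real because the area operator is Hermitian.
-/

set_option linter.unusedSectionVars false

namespace AreaLaw

/-! ### Spectral decompositions -/

section Spectral

open Polynomial
open scoped ComplexOrder

theorem sum_subtype_eq_sum {ι M : Type*} [Fintype ι] [AddCommMonoid M] (p : ι → Prop)
    [DecidablePred p] (f : ι → M) (h : ∀ i, ¬ p i → f i = 0) :
    ∑ i : {i // p i}, f i = ∑ i, f i := by
  rw [← Fintype.sum_subtype_add_sum_subtype p f,
    Finset.sum_eq_zero (s := (Finset.univ : Finset {i // ¬ p i})) fun i _ => h i i.2, add_zero]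

/-- The spectral theorem as an explicit product with a diagonal matrix. -/
theorem exists_diagonalization {c : Type*} [Fintype c] [DecidableEq c] {X : Matrix c c ℂ}
    (hX : X.IsHermitian) : ∃ U : Matrix c c ℂ, Uᴴ * U = 1 ∧ U * Uᴴ = 1 ∧
      X = U * Matrix.diagonal (fun i => (hX.eigenvalues i : ℂ)) * Uᴴ := by
  refine ⟨hX.eigenvectorUnitary, Unitary.coe_star_mul_self _, Unitary.coe_mul_star_self _, ?_⟩
  conv_lhs => rw [hX.spectral_theorem]
  rfl

theorem conj_pow {c : Type*} [Fintype c] [DecidableEq c] {U D : Matrix c c ℂ}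
    (h1 : Uᴴ * U = 1) (h2 : U * Uᴴ = 1) (k : ℕ) : (U * D * Uᴴ) ^ k = U * D ^ k * Uᴴ := by
  induction k with
  | zero => simp [h2]
  | succ k ih =>
    rw [pow_succ, ih, pow_succ]
    calc U * D ^ k * Uᴴ * (U * D * Uᴴ) = U * D ^ k * (Uᴴ * U) * D * Uᴴ := by noncomm_ring
      _ = _ := by rw [h1]; noncomm_ring

theorem trace_pow_eq_sum_eigenvalues_pow {c : Type*} [Fintype c] [DecidableEq c]
    {X : Matrix c c ℂ} (hX : X.IsHermitian) (k : ℕ) :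
    (X ^ k).trace = ((∑ i, hX.eigenvalues i ^ k : ℝ) : ℂ) := by
  obtain ⟨U, h1, h2, h⟩ := exists_diagonalization hX
  conv_lhs => rw [h]
  rw [conj_pow h1 h2, Matrix.trace_mul_comm, ← mul_assoc, h1, one_mul, Matrix.diagonal_pow,
    Matrix.trace_diagonal]
  simp

/-- Two finite families of reals with the same power sums of every positive order have the same
sum of `f`, for every `f` vanishing at `0`: the families may differ in the number of zeros only. -/
theorem sum_eq_of_power_sums_eq {ι κ : Type*} [Fintype ι] [Fintype κ] (x : ι → ℝ) (y : κ → ℝ)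
    (h : ∀ k : ℕ, ∑ i, x i ^ (k + 1) = ∑ i, y i ^ (k + 1)) (f : ℝ → ℝ) (hf : f 0 = 0) :
    ∑ i, f (x i) = ∑ i, f (y i) := by
  classical
  let s : Finset ℝ := insert 0 (Finset.univ.image x ∪ Finset.univ.image y)
  let p : ℝ[X] := Lagrange.interpolate s id f
  have hp : ∀ z ∈ s, p.eval z = f z := fun z hz =>
    Lagrange.eval_interpolate_at_node (v := id) f (Set.injOn_id _) hz
  have hx : ∀ i, f (x i) = p.eval (x i) := fun i => (hp _ (by simp [s])).symm
  have hy : ∀ i, f (y i) = p.eval (y i) := fun i => (hp _ (by simp [s])).symm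
  have h0 : p.coeff 0 = 0 := by
    rw [Polynomial.coeff_zero_eq_eval_zero, hp 0 (by simp [s]), hf]
  simp_rw [hx, hy, Polynomial.eval_eq_sum_range]
  rw [Finset.sum_comm, Finset.sum_comm (s := (Finset.univ : Finset κ))]
  refine Finset.sum_congr rfl fun k _ => ?_
  rw [← Finset.mul_sum, ← Finset.mul_sum]
  cases k with
  | zero => rw [h0, zero_mul, zero_mul]
  | succ k => rw [h k]

/-- The von Neumann entropy depends only on the traces of the positive powers. -/
theorem vonNeumannEntropy_eq_of_trace_pow_eq {a b : Type*} [Fintype a] [DecidableEq a]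
    [Fintype b] [DecidableEq b] {ρ : Matrix a a ℂ} {σ : Matrix b b ℂ} (hρ : ρ.IsHermitian)
    (hσ : σ.IsHermitian) (h : ∀ k : ℕ, (ρ ^ (k + 1)).trace = (σ ^ (k + 1)).trace) :
    vonNeumannEntropy ρ hρ = vonNeumannEntropy σ hσ := by
  refine sum_eq_of_power_sums_eq _ _ (fun k => ?_) _ Real.negMulLog_zero
  have := h k
  rw [trace_pow_eq_sum_eigenvalues_pow hρ, trace_pow_eq_sum_eigenvalues_pow hσ] at this
  exact_mod_cast this

/-- An orthogonal projection `E` is the sum of the `|f j⟩⟨f j|` over an orthonormal family `f`. -/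
theorem exists_orthonormal_of_projection {c : Type*} [Fintype c] [DecidableEq c]
    {E : Matrix c c ℂ} (hE : E.IsHermitian) (hE2 : E * E = E) :
    ∃ (m : ℕ) (f : Fin m → c → ℂ), (∀ j k, star (f j) ⬝ᵥ f k = if j = k then 1 else 0) ∧
      E = ∑ j, ketBra (f j) (f j) := by
  obtain ⟨U, h1, h2, h⟩ := exists_diagonalization hE
  have hl : ∀ i, hE.eigenvalues i = 1 ∨ hE.eigenvalues i = 0 := by
    intro i
    have hD : Uᴴ * E * U = Matrix.diagonal (fun i => (hE.eigenvalues i : ℂ)) := by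
      conv_lhs => rw [h]
      simp only [← mul_assoc, h1, one_mul]
      rw [mul_assoc, h1, mul_one]
    have hDD : (Uᴴ * E * U) * (Uᴴ * E * U) = Uᴴ * E * U := by
      calc (Uᴴ * E * U) * (Uᴴ * E * U) = Uᴴ * (E * (U * Uᴴ) * E) * U := by noncomm_ring
        _ = _ := by rw [h2, mul_one, hE2]
    rw [hD, Matrix.diagonal_mul_diagonal] at hDD
    have := congrFun (Matrix.diagonal_injective hDD) i
    have h' : hE.eigenvalues i * hE.eigenvalues i = hE.eigenvalues i := by exact_mod_cast this
    rcases eq_or_ne (hE.eigenvalues i) 0 with h0 | h0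
    · exact Or.inr h0
    · exact Or.inl (mul_right_cancel₀ h0 (by rw [h', one_mul]))
  let T := {i // hE.eigenvalues i = 1}
  let e : Fin (Fintype.card T) ≃ T := (Fintype.equivFin T).symm
  refine ⟨Fintype.card T, fun j x => U x (e j).1, ?_, ?_⟩
  · intro j k
    have := congrFun (congrFun h1 (e j).1) (e k).1
    simp only [Matrix.mul_apply, Matrix.conjTranspose_apply, Matrix.one_apply, Subtype.coe_inj,
      e.injective.eq_iff] at this
    simpa [dotProduct] using this
  · rw [e.sum_comp (fun t : T => ketBra (fun x => U x t.1) (fun x => U x t.1))]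
    ext x y
    conv_lhs => rw [h]
    rw [Matrix.mul_apply]
    simp only [Matrix.mul_diagonal, Matrix.conjTranspose_apply, Matrix.sum_apply, ketBra,
      Matrix.vecMulVec_apply, Pi.star_apply]
    rw [← sum_subtype_eq_sum (fun i => hE.eigenvalues i = 1)
      (fun i => U x i * (hE.eigenvalues i : ℂ) * star (U y i))]
    · exact Finset.sum_congr rfl fun t _ => by rw [t.2]; simp
    · intro i hi
      rw [(hl i).resolve_left hi]
      simp

/-- The Schmidt decomposition `V = ∑ k, s k • u k ⊗ w k`, together with vectors `g k` and `h k`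
showing that the Schmidt vectors lie in the ranges of `V` and of its transpose. -/
theorem exists_schmidt {a b : Type*} [Fintype a] [Fintype b] [DecidableEq b]
    (V : Matrix a b ℂ) :
    ∃ (r : ℕ) (s : Fin r → ℝ) (u g' : Fin r → a → ℂ) (w g : Fin r → b → ℂ),
      (∀ k l, star (u k) ⬝ᵥ u l = if k = l then 1 else 0) ∧
      (∀ k l, star (w k) ⬝ᵥ w l = if k = l then 1 else 0) ∧
      (∀ x y, V x y = ∑ k, (s k : ℂ) * u k x * w k y) ∧
      (∀ k, u k = V *ᵥ g k) ∧ (∀ k, w k = Vᵀ *ᵥ g' k) := by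
  have hB : (Vᴴ * V).IsHermitian := Matrix.isHermitian_conjTranspose_mul_self V
  obtain ⟨U, h1, h2, h⟩ := exists_diagonalization hB
  set lam := hB.eigenvalues with hlam
  -- The columns of `T` are the images under `V` of the eigenvectors of `Vᴴ * V`.
  set T := V * U with hT
  have hTT : Tᴴ * T = Matrix.diagonal (fun i => (lam i : ℂ)) := by
    rw [hT, Matrix.conjTranspose_mul]
    calc Uᴴ * Vᴴ * (V * U) = Uᴴ * (Vᴴ * V) * U := by simp only [Matrix.mul_assoc]
      _ = Uᴴ * (U * Matrix.diagonal (fun i => (lam i : ℂ)) * Uᴴ) * U := by rw [← h]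
      _ = (Uᴴ * U) * Matrix.diagonal (fun i => (lam i : ℂ)) * (Uᴴ * U) := by
        simp only [Matrix.mul_assoc]
      _ = _ := by rw [h1, one_mul, mul_one]
  have hVT : Vᴴ * T = U * Matrix.diagonal (fun i => (lam i : ℂ)) := by
    rw [hT, ← Matrix.mul_assoc]
    conv_lhs => rw [h]
    rw [mul_assoc, h1, mul_one]
  have hV : V = T * Uᴴ := by rw [hT, Matrix.mul_assoc, h2, Matrix.mul_one]
  have hTe : ∀ i j, ∑ x, star (T x i) * T x j = if i = j then (lam i : ℂ) else 0 := by
    intro i j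
    have := congrFun (congrFun hTT i) j
    simpa [Matrix.mul_apply, Matrix.diagonal_apply] using this
  have hnn : ∀ i, 0 ≤ lam i := fun i =>
    (Matrix.posSemidef_conjTranspose_mul_self V).eigenvalues_nonneg i
  have hz : ∀ i, lam i = 0 → ∀ x, T x i = 0 := by
    intro i hi x
    have h0 := hTe i i
    rw [if_pos rfl, hi] at h0
    have : star (fun x => T x i) ⬝ᵥ (fun x => T x i) = 0 := by
      simpa [dotProduct] using h0
    exact congrFun (dotProduct_star_self_eq_zero.1 this) x
  let I := {i // lam i ≠ 0}
  let e : Fin (Fintype.card I) ≃ I := (Fintype.equivFin I).symm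
  have hs : ∀ k, ((√(lam (e k).1) : ℝ) : ℂ) ≠ 0 := fun k => by
    exact_mod_cast (Real.sqrt_pos.2 (lt_of_le_of_ne (hnn _) (e k).2.symm)).ne'
  have hss : ∀ k, ((√(lam (e k).1) : ℝ) : ℂ) * ((√(lam (e k).1) : ℝ) : ℂ) = lam (e k).1 :=
    fun k => by exact_mod_cast Real.mul_self_sqrt (hnn _)
  refine ⟨Fintype.card I, fun k => √(lam (e k).1),
    fun k x => ((√(lam (e k).1) : ℝ) : ℂ)⁻¹ * T x (e k).1,
    fun k x => (lam (e k).1 : ℂ)⁻¹ * star (T x (e k).1),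
    fun k y => star (U y (e k).1),
    fun k y => ((√(lam (e k).1) : ℝ) : ℂ)⁻¹ * U y (e k).1, ?_, ?_, ?_, ?_, ?_⟩
  · intro k l
    have : ∀ x, star (((√(lam (e k).1) : ℝ) : ℂ)⁻¹ * T x (e k).1)
        * (((√(lam (e l).1) : ℝ) : ℂ)⁻¹ * T x (e l).1)
        = ((√(lam (e k).1) : ℝ) : ℂ)⁻¹ * ((√(lam (e l).1) : ℝ) : ℂ)⁻¹
          * (star (T x (e k).1) * T x (e l).1) := by
      intro x
      simp only [star_mul', star_inv₀, Complex.star_def, Complex.conj_ofReal]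
      ring
    simp only [dotProduct, Pi.star_apply, this, ← Finset.mul_sum, hTe, Subtype.coe_inj,
      e.injective.eq_iff]
    split_ifs with hkl
    · subst hkl
      rw [← hss k]
      field_simp [hs k]
    · simp
  · intro k l
    have := congrFun (congrFun h1 (e l).1) (e k).1
    simp only [Matrix.mul_apply, Matrix.conjTranspose_apply, Matrix.one_apply, Subtype.coe_inj,
      e.injective.eq_iff] at this
    simpa [dotProduct, mul_comm, eq_comm] using this
  · intro x y
    have hk : ∀ k, ((√(lam (e k).1) : ℝ) : ℂ) * (((√(lam (e k).1) : ℝ) : ℂ)⁻¹ * T x (e k).1)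
        * star (U y (e k).1) = T x (e k).1 * star (U y (e k).1) := fun k => by
      rw [mul_inv_cancel_left₀ (hs k)]
    simp only [hk]
    rw [e.sum_comp (fun t : I => T x t.1 * star (U y t.1))]
    conv_lhs => rw [hV]
    rw [Matrix.mul_apply]
    simp only [Matrix.conjTranspose_apply]
    refine (sum_subtype_eq_sum (fun i => lam i ≠ 0)
      (fun i => T x i * star (U y i)) fun i hi => ?_).symm
    rw [hz i (not_not.1 hi) x, zero_mul]
  · intro k
    ext x
    simp only [hT, Matrix.mul_apply, Matrix.mulVec, dotProduct, Finset.mul_sum]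
    exact Finset.sum_congr rfl fun y _ => by ring
  · intro k
    ext y
    have := congrArg star (congrFun (congrFun hVT y) (e k).1)
    rw [Matrix.mul_diagonal, Matrix.mul_apply] at this
    simp only [Matrix.conjTranspose_apply, star_sum, star_mul', star_star] at this
    have hne : (lam (e k).1 : ℂ) ≠ 0 := by exact_mod_cast (e k).2
    simp only [Matrix.mulVec, dotProduct, Matrix.transpose_apply]
    have h3 : ∀ x, V x y * ((lam (e k).1 : ℂ)⁻¹ * star (T x (e k).1))
        = (lam (e k).1 : ℂ)⁻¹ * (V x y * star (T x (e k).1)) := fun x => by ring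
    simp only [h3, ← Finset.mul_sum, this]
    rw [Complex.star_def, Complex.conj_ofReal]
    field_simp

end Spectral

/-! ### Matrix units of a finite-dimensional star-algebra -/

section Wedderburn

open Polynomial
open scoped ComplexOrder

variable {c : Type*} [Fintype c] [DecidableEq c]

theorem aeval_conj_diagonal {U : Matrix c c ℂ} (d : c → ℂ)
    (h1 : Uᴴ * U = 1) (h2 : U * Uᴴ = 1) (p : ℂ[X]) :
    aeval (U * Matrix.diagonal d * Uᴴ) p = U * Matrix.diagonal (fun i => p.eval (d i)) * Uᴴ := by
  have : Matrix.diagonal (fun i => p.eval (d i)) =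
      ∑ k ∈ Finset.range (p.natDegree + 1), p.coeff k • Matrix.diagonal d ^ k := by
    ext i j
    simp only [Matrix.diagonal_pow, Matrix.sum_apply, Matrix.smul_apply, Matrix.diagonal_apply]
    split_ifs
    · simp [Polynomial.eval_eq_sum_range]
    · simp
  rw [aeval_eq_sum_range, this, Finset.mul_sum, Finset.sum_mul]
  refine Finset.sum_congr rfl fun k _ => ?_
  rw [conj_pow h1 h2]
  simp

theorem aeval_mem_of_coeff_zero {M : NonUnitalStarSubalgebra ℂ (Matrix c c ℂ)}
    {X : Matrix c c ℂ} (hX : X ∈ M) {p : ℂ[X]} (hp : p.coeff 0 = 0) : aeval X p ∈ M := by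
  rw [aeval_eq_sum_range]
  have hpow : ∀ k : ℕ, X ^ (k + 1) ∈ M := fun k => by
    induction k with
    | zero => simpa using hX
    | succ k ih => rw [pow_succ]; exact mul_mem ih hX
  refine sum_mem fun k _ => ?_
  cases k with
  | zero => rw [hp, zero_smul]; exact zero_mem _
  | succ k => exact SMulMemClass.smul_mem _ (hpow k)

/-- A nonzero Hermitian element of a star-subalgebra has a spectral projection, for a nonzero
eigenvalue, in the subalgebra. -/
theorem exists_spectral_projection_mem {M : NonUnitalStarSubalgebra ℂ (Matrix c c ℂ)}
    {X : Matrix c c ℂ} (hX : X ∈ M) (hh : X.IsHermitian) (h0 : X ≠ 0) :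
    ∃ (E : Matrix c c ℂ) (l : ℂ), E ∈ M ∧ Eᴴ = E ∧ E * E = E ∧ E ≠ 0 ∧ l ≠ 0 ∧
      X * E = l • E ∧ E * X = l • E := by
  classical
  obtain ⟨U, h1, h2, h⟩ := exists_diagonalization hh
  set d : c → ℂ := fun i => (hh.eigenvalues i : ℂ) with hd
  obtain ⟨i₀, hi₀⟩ : ∃ i, d i ≠ 0 := by
    by_contra! hcon
    apply h0
    rw [h, show d = 0 from funext hcon]
    simp
  -- The polynomial equal to `1` at the chosen eigenvalue and to `0` at `0` and the others.
  let s : Finset ℂ := insert 0 (Finset.univ.image d)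
  let p : ℂ[X] := Lagrange.interpolate s id (fun z => if z = d i₀ then 1 else 0)
  have hp : ∀ z ∈ s, p.eval z = if z = d i₀ then 1 else 0 := fun z hz =>
    Lagrange.eval_interpolate_at_node (v := id) _ (Set.injOn_id _) hz
  have hp0 : p.coeff 0 = 0 := by
    rw [Polynomial.coeff_zero_eq_eval_zero, hp 0 (by simp [s]), if_neg hi₀.symm]
  let χ : c → ℂ := fun i => if d i = d i₀ then 1 else 0
  have hE : aeval X p = U * Matrix.diagonal χ * Uᴴ := by
    conv_lhs => rw [h, aeval_conj_diagonal d h1 h2]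
    congr 3
    ext i
    exact hp _ (by simp [s])
  have hmul : ∀ D D' : Matrix c c ℂ, (U * D * Uᴴ) * (U * D' * Uᴴ) = U * (D * D') * Uᴴ := by
    intro D D'
    calc _ = U * D * (Uᴴ * U) * D' * Uᴴ := by noncomm_ring
      _ = _ := by rw [h1]; noncomm_ring
  refine ⟨aeval X p, d i₀, aeval_mem_of_coeff_zero hX hp0, ?_, ?_, ?_, hi₀, ?_, ?_⟩
  · rw [hE, Matrix.conjTranspose_mul, Matrix.conjTranspose_mul, Matrix.conjTranspose_conjTranspose,
      Matrix.diagonal_conjTranspose, mul_assoc]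
    congr 3
    ext i
    simp only [χ, Pi.star_apply]
    split_ifs <;> simp
  · rw [hE, hmul, Matrix.diagonal_mul_diagonal]
    congr 3
    ext i
    simp only [χ]
    split_ifs <;> simp
  · intro hz
    have : Matrix.diagonal χ = 0 := by
      have : Uᴴ * aeval X p * U = Matrix.diagonal χ := by
        rw [hE]
        calc _ = (Uᴴ * U) * Matrix.diagonal χ * (Uᴴ * U) := by noncomm_ring
          _ = _ := by rw [h1, one_mul, mul_one]
      rw [← this, hz, mul_zero, zero_mul]
    have := congrFun (congrFun this i₀) i₀
    simp [χ] at this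
  all_goals
    rw [hE]
    conv_lhs => rw [h]
    rw [hmul, Matrix.diagonal_mul_diagonal]
    rw [← Matrix.smul_mul, ← Matrix.mul_smul, ← Matrix.diagonal_smul]
    congr 3
    ext i
    simp only [χ, Pi.smul_apply, smul_eq_mul]
    split_ifs with hi <;> simp [hi]

/-- `p` is a finite family of nonzero, pairwise orthogonal projections of `M` with sum `P`. -/
structure IsProjectionPartition (M : NonUnitalStarSubalgebra ℂ (Matrix c c ℂ))
    (P : Matrix c c ℂ) {ι : Type} [Fintype ι] (p : ι → Matrix c c ℂ) : Prop where
  mem : ∀ s, p s ∈ M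
  herm : ∀ s, (p s)ᴴ = p s
  idem : ∀ s, p s * p s = p s
  ne_zero : ∀ s, p s ≠ 0
  orth : ∀ s t, s ≠ t → p s * p t = 0
  sum_eq : ∑ s, p s = P

theorem IsProjectionPartition.card_le {M : NonUnitalStarSubalgebra ℂ (Matrix c c ℂ)}
    {P : Matrix c c ℂ} {ι : Type} [Fintype ι] {p : ι → Matrix c c ℂ}
    (hp : IsProjectionPartition M P p) :
    Fintype.card ι ≤ Module.finrank ℂ (Matrix c c ℂ) := by
  refine LinearIndependent.fintype_card_le_finrank (R := ℂ) (b := p) ?_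
  rw [Fintype.linearIndependent_iff]
  intro g hg s
  have := congrArg (fun Y => p s * Y) hg
  simp only [Finset.mul_sum, Matrix.mul_smul, mul_zero] at this
  rw [Finset.sum_eq_single s (fun t _ ht => by rw [hp.orth s t ht.symm, smul_zero])
    (by simp), hp.idem] at this
  exact (smul_eq_zero.1 this).resolve_right (hp.ne_zero s)

/-- Replacing one projection of a partition by two orthogonal parts of it. -/
theorem IsProjectionPartition.split {M : NonUnitalStarSubalgebra ℂ (Matrix c c ℂ)}
    {P : Matrix c c ℂ} {ι : Type} [Fintype ι] [DecidableEq ι] {p : ι → Matrix c c ℂ}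
    (hp : IsProjectionPartition M P p) (s₀ : ι) {E : Matrix c c ℂ} (hE : E ∈ M) (hEh : Eᴴ = E)
    (hEi : E * E = E) (hE0 : E ≠ 0) (hne : E ≠ p s₀) (hl : p s₀ * E = E) (hr : E * p s₀ = E) :
    IsProjectionPartition M P (fun o : Option ι =>
      o.elim E (fun s => if s = s₀ then p s₀ - E else p s)) := by
  have hz : ∀ s, s ≠ s₀ → p s * E = 0 := fun s hs => by
    rw [← hl, ← mul_assoc, hp.orth s s₀ hs, zero_mul]
  have hz' : ∀ s, s ≠ s₀ → E * p s = 0 := fun s hs => by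
    rw [← hr, mul_assoc, hp.orth s₀ s hs.symm, mul_zero]
  refine ⟨?_, ?_, ?_, ?_, ?_, ?_⟩
  · rintro (_ | s)
    · exact hE
    · dsimp only [Option.elim]
      split_ifs
      · exact sub_mem (hp.mem _) hE
      · exact hp.mem s
  · rintro (_ | s)
    · exact hEh
    · dsimp only [Option.elim]
      split_ifs
      · rw [Matrix.conjTranspose_sub, hp.herm, hEh]
      · exact hp.herm s
  · rintro (_ | s)
    · exact hEi
    · dsimp only [Option.elim]
      split_ifs
      · rw [sub_mul, mul_sub, mul_sub, hp.idem, hEi, hl, hr]; simp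
      · exact hp.idem s
  · rintro (_ | s)
    · exact hE0
    · dsimp only [Option.elim]
      split_ifs
      · exact sub_ne_zero.2 hne.symm
      · exact hp.ne_zero s
  · rintro (_ | s) (_ | t) hst
    · exact absurd rfl hst
    · dsimp only [Option.elim]
      split_ifs with h
      · rw [mul_sub, hr, hEi, sub_self]
      · exact hz' t h
    · dsimp only [Option.elim]
      split_ifs with h
      · rw [sub_mul, hl, hEi, sub_self]
      · exact hz s h
    · have hst' : s ≠ t := fun h => hst (by rw [h])
      dsimp only [Option.elim]
      split_ifs with h h' h'
      · exact absurd (h.trans h'.symm) hst'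
      · rw [sub_mul, hz' t h', sub_zero, hp.orth _ _ (Ne.symm h')]
      · rw [mul_sub, hz s h, sub_zero, hp.orth _ _ h]
      · exact hp.orth s t hst'
  · rw [Fintype.sum_option, ← hp.sum_eq]
    simp only [Option.elim]
    rw [← Finset.add_sum_erase _ _ (Finset.mem_univ s₀),
      ← Finset.add_sum_erase _ p (Finset.mem_univ s₀), if_pos rfl]
    rw [Finset.sum_congr rfl fun s hs => if_neg (Finset.ne_of_mem_erase hs)]
    abel

/-- A maximal partition of the unit into projections of `M` consists of minimal projections:
each of its members compresses `M` to scalars. -/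
theorem exists_minimal_partition (M : NonUnitalStarSubalgebra ℂ (Matrix c c ℂ))
    {P : Matrix c c ℂ} (hPM : P ∈ M) (hPh : Pᴴ = P) (hPi : P * P = P) :
    ∃ (ι : Type) (_ : Fintype ι) (p : ι → Matrix c c ℂ), IsProjectionPartition M P p ∧
      ∀ s, ∀ X ∈ M, ∃ z : ℂ, p s * X * p s = z • p s := by
  classical
  -- The size of a partition is bounded, so there is a partition of maximal size. A Hermitian
  -- compression of an element of `M` that is not a scalar would split one of its members.
  let Q : ℕ → Prop := fun r => ∃ (ι : Type) (_ : Fintype ι) (p : ι → Matrix c c ℂ),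
    IsProjectionPartition M P p ∧ Fintype.card ι = r
  have hex : ∃ r, Q r := by
    by_cases h0 : P = 0
    · exact ⟨_, Empty, inferInstance, fun x => x.elim,
        ⟨fun x => x.elim, fun x => x.elim, fun x => x.elim, fun x => x.elim, fun x => x.elim,
          by simp [h0]⟩, rfl⟩
    · exact ⟨_, Unit, inferInstance, fun _ => P,
        ⟨fun _ => hPM, fun _ => hPh, fun _ => hPi, fun _ => h0, fun s t h => absurd rfl h,
          by simp⟩, rfl⟩
  obtain ⟨r, hr⟩ := hex
  have hb : ∀ r, Q r → r ≤ Module.finrank ℂ (Matrix c c ℂ) := by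
    rintro r ⟨ι, _, p, hp, rfl⟩
    exact hp.card_le
  obtain ⟨ι, hι, p, hp, hcard⟩ := Nat.findGreatest_spec (hb r hr) hr
  have hherm : ∀ s, ∀ X ∈ M, Xᴴ = X → ∃ z : ℂ, p s * X * p s = z • p s := by
    intro s X hX hXh
    by_contra! hcon
    have hYM : p s * X * p s ∈ M := mul_mem (mul_mem (hp.mem s) hX) (hp.mem s)
    have hYh : (p s * X * p s).IsHermitian := by
      rw [Matrix.IsHermitian, Matrix.conjTranspose_mul, Matrix.conjTranspose_mul, hp.herm, hXh,
        mul_assoc]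
    obtain ⟨E, l, hE, hEh, hEi, hE0, hl0, h1, h2⟩ := exists_spectral_projection_mem hYM hYh
      (by simpa using hcon 0)
    have hl : p s * E = E := by
      have : E = l⁻¹ • (p s * X * p s * E) := by rw [h1, smul_smul, inv_mul_cancel₀ hl0, one_smul]
      rw [this, Matrix.mul_smul]
      simp only [← mul_assoc, hp.idem]
    have hr : E * p s = E := by
      have : E = l⁻¹ • (E * (p s * X * p s)) := by
        rw [h2, smul_smul, inv_mul_cancel₀ hl0, one_smul]
      rw [this, Matrix.smul_mul]
      simp only [mul_assoc, hp.idem]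
    have hne : E ≠ p s := by
      rintro rfl
      refine hcon l ?_
      rw [← h1, mul_assoc (p s * X), hp.idem]
    have hQ := hp.split s hE hEh hEi hE0 hne hl hr
    have hQ' : Q (Fintype.card (Option ι)) := ⟨Option ι, inferInstance, _, hQ, rfl⟩
    have := Nat.le_findGreatest (hb _ hQ') hQ'
    rw [← hcard, Fintype.card_option] at this
    omega
  refine ⟨ι, hι, p, hp, fun s X hX => ?_⟩
  -- A general element is a combination of two Hermitian ones.
  have hXs : Xᴴ ∈ M := star_mem hX
  obtain ⟨z1, h1⟩ := hherm s (X + Xᴴ) (add_mem hX hXs) (by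
    rw [Matrix.conjTranspose_add, Matrix.conjTranspose_conjTranspose, add_comm])
  obtain ⟨z2, h2⟩ := hherm s (Complex.I • (X - Xᴴ)) (SMulMemClass.smul_mem _ (sub_mem hX hXs)) (by
    rw [Matrix.conjTranspose_smul, Matrix.conjTranspose_sub, Matrix.conjTranspose_conjTranspose]
    rw [← neg_sub X, smul_neg, ← neg_smul]
    simp)
  refine ⟨(1 / 2) * (z1 - Complex.I * z2), ?_⟩
  have hX2 : X = (1 / 2 : ℂ) • ((X + Xᴴ) - Complex.I • (Complex.I • (X - Xᴴ))) := by
    rw [smul_smul, Complex.I_mul_I]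
    module
  conv_lhs => rw [hX2]
  rw [Matrix.mul_smul, Matrix.smul_mul, mul_sub, sub_mul, h1, Matrix.mul_smul, Matrix.smul_mul, h2]
  module

/-- Equivalence of projections `p`, `q` of `M`, witnessed by a partial isometry `u` in `M`. -/
structure IsPartialIsometryBetween (M : NonUnitalStarSubalgebra ℂ (Matrix c c ℂ))
    (p q u : Matrix c c ℂ) : Prop where
  mem : u ∈ M
  range_eq : u * uᴴ = p
  source_eq : uᴴ * u = q
  left : p * u = u
  right : u * q = u

theorem IsPartialIsometryBetween.symm {M : NonUnitalStarSubalgebra ℂ (Matrix c c ℂ)}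
    {p q u : Matrix c c ℂ} (h : IsPartialIsometryBetween M p q u) (hp : pᴴ = p) (hq : qᴴ = q) :
    IsPartialIsometryBetween M q p uᴴ where
  mem := star_mem h.mem
  range_eq := by rw [Matrix.conjTranspose_conjTranspose, h.source_eq]
  source_eq := by rw [Matrix.conjTranspose_conjTranspose, h.range_eq]
  left := by
    conv_lhs => rw [← hq]
    rw [← Matrix.conjTranspose_mul, h.right]
  right := by
    conv_lhs => rw [← hp]
    rw [← Matrix.conjTranspose_mul, h.left]

theorem IsPartialIsometryBetween.trans {M : NonUnitalStarSubalgebra ℂ (Matrix c c ℂ)}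
    {p q r u v : Matrix c c ℂ} (h : IsPartialIsometryBetween M p q u)
    (h' : IsPartialIsometryBetween M q r v) : IsPartialIsometryBetween M p r (u * v) where
  mem := mul_mem h.mem h'.mem
  range_eq := by
    rw [Matrix.conjTranspose_mul, ← mul_assoc, mul_assoc u, h'.range_eq, h.right, h.range_eq]
  source_eq := by
    rw [Matrix.conjTranspose_mul, ← mul_assoc, mul_assoc vᴴ, h.source_eq, mul_assoc, h'.left,
      h'.source_eq]
  left := by rw [← mul_assoc, h.left]
  right := by rw [mul_assoc, h'.right]

/-- Minimal projections `p`, `q` with `p X q ≠ 0` for some `X` in `M` are equivalent in `M`. -/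
theorem exists_partialIsometry {M : NonUnitalStarSubalgebra ℂ (Matrix c c ℂ)}
    {p q : Matrix c c ℂ} (hpM : p ∈ M) (hqM : q ∈ M) (hp : pᴴ = p) (hq : qᴴ = q)
    (hpi : p * p = p) (hqi : q * q = q)
    (hpm : ∀ X ∈ M, ∃ z : ℂ, p * X * p = z • p) (hqm : ∀ X ∈ M, ∃ z : ℂ, q * X * q = z • q)
    {X : Matrix c c ℂ} (hX : X ∈ M) (h0 : p * X * q ≠ 0) :
    ∃ u, IsPartialIsometryBetween M p q u := by
  set Y := p * X * q with hY
  have hYM : Y ∈ M := mul_mem (mul_mem hpM hX) hqM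
  have hpY : p * Y = Y := by rw [hY, ← mul_assoc, ← mul_assoc, hpi]
  have hYq : Y * q = Y := by rw [hY, mul_assoc, hqi]
  have hYp : Yᴴ * p = Yᴴ := by
    conv_lhs => rw [← hp]
    rw [← Matrix.conjTranspose_mul, hpY]
  have hqY : q * Yᴴ = Yᴴ := by
    conv_lhs => rw [← hq]
    rw [← Matrix.conjTranspose_mul, hYq]
  obtain ⟨z, hz⟩ := hpm (Y * Yᴴ) (mul_mem hYM (star_mem hYM))
  obtain ⟨z', hz'⟩ := hqm (Yᴴ * Y) (mul_mem (star_mem hYM) hYM)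
  have hz : Y * Yᴴ = z • p := by
    rw [← hz, ← mul_assoc, hpY, mul_assoc Y, hYp]
  have hz' : Yᴴ * Y = z' • q := by
    rw [← hz', ← mul_assoc q, hqY, mul_assoc Yᴴ, hYq]
  have hzz : z = z' := by
    have : z • Y = z' • Y := by
      calc z • Y = (z • p) * Y := by rw [Matrix.smul_mul, hpY]
        _ = Y * (Yᴴ * Y) := by rw [← hz, mul_assoc]
        _ = _ := by rw [hz', Matrix.mul_smul, hYq]
    exact smul_left_injective ℂ h0 this
  subst hzz
  -- The scalar `z` is positive, since `z tr p = tr (Y Yᴴ) > 0` and `tr p = tr (p pᴴ) ≥ 0`.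
  have hz0 : 0 < z := by
    have hYp : 0 < (Y * Yᴴ).trace := by
      refine lt_of_le_of_ne (Matrix.posSemidef_self_mul_conjTranspose Y).trace_nonneg ?_
      intro h
      exact h0 (Matrix.trace_mul_conjTranspose_self_eq_zero_iff.1 h.symm)
    have hpp : 0 ≤ p.trace := by
      have := (Matrix.posSemidef_self_mul_conjTranspose p).trace_nonneg
      rwa [hp, hpi] at this
    rw [hz, Matrix.trace_smul, smul_eq_mul] at hYp
    exact pos_of_mul_pos_left hYp hpp
  obtain ⟨t, ht, htz⟩ : ∃ t : ℝ, 0 < t ∧ z = ((t * t : ℝ) : ℂ) := by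
    obtain ⟨x, hx, rfl⟩ : ∃ x : ℝ, 0 < x ∧ (x : ℂ) = z := by
      refine ⟨z.re, (Complex.pos_iff.1 hz0).1, ?_⟩
      exact Complex.ext rfl (Complex.pos_iff.1 hz0).2
    exact ⟨√x, Real.sqrt_pos.2 hx, by rw [Real.mul_self_sqrt hx.le]⟩
  have htc : (t : ℂ) ≠ 0 := by exact_mod_cast ht.ne'
  have hs : ((t : ℂ)⁻¹ • Y)ᴴ = (t : ℂ)⁻¹ • Yᴴ := by
    rw [Matrix.conjTranspose_smul, star_inv₀, Complex.star_def, Complex.conj_ofReal]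
  refine ⟨(t : ℂ)⁻¹ • Y, SMulMemClass.smul_mem _ hYM, ?_, ?_, ?_, ?_⟩
  · rw [hs, Matrix.smul_mul, Matrix.mul_smul, hz, smul_smul, smul_smul, htz]
    push_cast
    rw [show (t : ℂ)⁻¹ * (t : ℂ)⁻¹ * (t * t) = 1 by field_simp, one_smul]
  · rw [hs, Matrix.smul_mul, Matrix.mul_smul, hz', smul_smul, smul_smul, htz]
    push_cast
    rw [show (t : ℂ)⁻¹ * (t : ℂ)⁻¹ * (t * t) = 1 by field_simp, one_smul]
  · rw [Matrix.mul_smul, hpY]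
  · rw [Matrix.smul_mul, hYq]

/-- A system of matrix units for a star-algebra `M` of matrices with unit `P`: one projection `q α`
for each simple summand, and partial isometries `u α i` in `M` with initial projection `q α`, whose
final projections partition `P`. The matrix units are the products `u α i * (u α j)ᴴ`; they span
`M`. -/
structure MatrixUnits (M : NonUnitalStarSubalgebra ℂ (Matrix c c ℂ)) (P : Matrix c c ℂ) where
  Sector : Type
  [fintypeSector : Fintype Sector]
  A₁ : Sector → Type
  [fintypeA₁ : ∀ α, Fintype (A₁ α)]
  q : Sector → Matrix c c ℂ
  u : ∀ α, A₁ α → Matrix c c ℂ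
  nonempty : ∀ α, Nonempty (A₁ α)
  q_herm : ∀ α, (q α)ᴴ = q α
  q_idem : ∀ α, q α * q α = q α
  q_ne_zero : ∀ α, q α ≠ 0
  u_mem : ∀ α i, u α i ∈ M
  u_mul_q : ∀ α i, u α i * q α = u α i
  conj_mul_self : ∀ α i, (u α i)ᴴ * u α i = q α
  conj_mul_of_ne : ∀ α i j, i ≠ j → (u α i)ᴴ * u α j = 0
  conj_mul_of_sector_ne : ∀ α β i j, α ≠ β → (u α i)ᴴ * u β j = 0
  sum_eq : ∑ α, ∑ i, u α i * (u α i)ᴴ = P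
  span : ∀ X ∈ M, ∃ O : ∀ α, Matrix (A₁ α) (A₁ α) ℂ,
    X = ∑ α, ∑ i, ∑ j, O α i j • (u α i * (u α j)ᴴ)

attribute [instance] MatrixUnits.fintypeSector MatrixUnits.fintypeA₁

/-- The structure theorem for star-algebras of matrices. -/
theorem exists_matrixUnits (M : NonUnitalStarSubalgebra ℂ (Matrix c c ℂ))
    {P : Matrix c c ℂ} (hPM : P ∈ M) (hPh : Pᴴ = P) (hPi : P * P = P)
    (hPl : ∀ X ∈ M, P * X = X) (hPr : ∀ X ∈ M, X * P = X) : Nonempty (MatrixUnits M P) := by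
  classical
  obtain ⟨ι, hι, p, hp, hmin⟩ := exists_minimal_partition M hPM hPh hPi
  -- The sectors are the classes of members connected by a partial isometry in `M`.
  let st : Setoid ι :=
    { r := fun s t => ∃ u, IsPartialIsometryBetween M (p s) (p t) u
      iseqv :=
        ⟨fun s => ⟨p s, hp.mem s, by rw [hp.herm, hp.idem], by rw [hp.herm, hp.idem], hp.idem s,
            hp.idem s⟩,
          fun ⟨u, hu⟩ => ⟨uᴴ, hu.symm (hp.herm _) (hp.herm _)⟩,
          fun ⟨u, hu⟩ ⟨v, hv⟩ => ⟨u * v, hu.trans hv⟩⟩ }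
  have hrep : ∀ s, ∃ u, IsPartialIsometryBetween M (p s) (p (Quotient.mk st s).out) u :=
    fun s => st.symm (Quotient.mk_out (s := st) s)
  choose v hv using hrep
  have hzero : ∀ s t, Quotient.mk st s ≠ Quotient.mk st t → ∀ X ∈ M, p s * X * p t = 0 := by
    intro s t hst X hX
    by_contra h0
    exact hst (Quotient.sound (exists_partialIsometry (hp.mem s) (hp.mem t) (hp.herm s)
      (hp.herm t) (hp.idem s) (hp.idem t) (hmin s) (hmin t) hX h0))
  have hvl : ∀ s, (v s)ᴴ * p s = (v s)ᴴ := fun s => ((hv s).symm (hp.herm _) (hp.herm _)).right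
  have horth : ∀ s t, s ≠ t → (v s)ᴴ * v t = 0 := fun s t hst => by
    rw [← hvl s, ← (hv t).left, ← mul_assoc, mul_assoc _ (p s), hp.orth s t hst, mul_zero,
      zero_mul]
  -- Sums over the sectors and their members are sums over `ι`.
  have hfib : ∀ f : ι → Matrix c c ℂ,
      ∑ α : Quotient st, ∑ i : {s // Quotient.mk st s = α}, f i = ∑ s, f s := fun f => by
    rw [← (Equiv.sigmaFiberEquiv (Quotient.mk st)).sum_comp, Fintype.sum_sigma]
    rfl
  refine ⟨⟨Quotient st, fun α => {s // Quotient.mk st s = α},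
    fun α => p α.out, fun α i => v i.1, ?_, fun α => hp.herm _, fun α => hp.idem _,
    fun α => hp.ne_zero _, fun α i => (hv _).mem, ?_, ?_, ?_, ?_, ?_, ?_⟩⟩
  · exact fun α => ⟨⟨α.out, Quotient.out_eq α⟩⟩
  · rintro α ⟨s, rfl⟩
    exact (hv s).right
  · rintro α ⟨s, rfl⟩
    exact (hv s).source_eq
  · intro α i j hij
    exact horth _ _ fun h => hij (Subtype.ext h)
  · rintro α β ⟨s, rfl⟩ ⟨t, rfl⟩ hαβ
    exact horth _ _ fun h => hαβ (congrArg _ h)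
  · rw [hfib fun s => v s * (v s)ᴴ, ← hp.sum_eq]
    exact Finset.sum_congr rfl fun s _ => (hv s).range_eq
  · intro X hX
    have hsc : ∀ s t, Quotient.mk st s = Quotient.mk st t →
        ∃ z : ℂ, p s * X * p t = z • (v s * (v t)ᴴ) := by
      intro s t hst
      obtain ⟨z, hz⟩ := hmin (Quotient.mk st s).out ((v s)ᴴ * X * v t)
        (mul_mem (mul_mem (star_mem (hv s).mem) hX) (hv t).mem)
      refine ⟨z, ?_⟩
      have ht := hv t
      rw [← hst] at ht
      calc p s * X * p t = (v s * (v s)ᴴ) * X * (v t * (v t)ᴴ) := by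
            rw [(hv s).range_eq, ht.range_eq]
        _ = (v s * p (Quotient.mk st s).out) * (v s)ᴴ * X * (v t * p (Quotient.mk st s).out)
              * (v t)ᴴ := by rw [(hv s).right, ht.right]; noncomm_ring
        _ = v s * (p (Quotient.mk st s).out * ((v s)ᴴ * X * v t) * p (Quotient.mk st s).out)
              * (v t)ᴴ := by noncomm_ring
        _ = z • ((v s * p (Quotient.mk st s).out) * (v t)ᴴ) := by
            rw [hz, Matrix.mul_smul, Matrix.smul_mul]
        _ = _ := by rw [(hv s).right]
    have hsc' : ∀ s t, ∃ z : ℂ, Quotient.mk st s = Quotient.mk st t →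
        p s * X * p t = z • (v s * (v t)ᴴ) := fun s t => by
      by_cases h : Quotient.mk st s = Quotient.mk st t
      · obtain ⟨z, hz⟩ := hsc s t h
        exact ⟨z, fun _ => hz⟩
      · exact ⟨0, fun h' => absurd h' h⟩
    choose z hz using hsc'
    refine ⟨fun α => Matrix.of fun i j => z i.1 j.1, ?_⟩
    have hrow : ∀ s : ι, p s * X = ∑ j : {t // Quotient.mk st t = Quotient.mk st s},
        z s j.1 • (v s * (v j.1)ᴴ) := by
      intro s
      rw [← hPr X hX, ← hp.sum_eq, Finset.mul_sum, Finset.mul_sum,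
        ← sum_subtype_eq_sum (fun t => Quotient.mk st t = Quotient.mk st s)]
      · refine Finset.sum_congr rfl fun j _ => ?_
        rw [← mul_assoc, hz s j.1 j.2.symm]
      · intro t ht
        rw [← mul_assoc]
        exact hzero s t (fun h => ht h.symm) X hX
    calc X = ∑ s, p s * X := by rw [← Finset.sum_mul, hp.sum_eq, hPl X hX]
      _ = _ := by
        rw [← hfib fun s => p s * X]
        refine Finset.sum_congr rfl fun α _ => Finset.sum_congr rfl ?_
        rintro ⟨s, rfl⟩ _
        exact hrow s

end Wedderburn

/-! ### Code subalgebras -/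

section CodeSubalgebra

variable {a b : Type*} [Fintype a] [DecidableEq a] [Fintype b] [DecidableEq b]

/-- The logical operators supported on `A` are the restrictions to the code of the operators on
`H_A` that commute with the code projector. -/
theorem mem_codeSubalgebraA_iff {P : Matrix (a × b) (a × b) ℂ} (hP : Pᴴ = P)
    {X : Matrix (a × b) (a × b) ℂ} :
    X ∈ codeSubalgebraA P ↔ ∃ O : Matrix a a ℂ,
      (O ⊗ₖ (1 : Matrix b b ℂ)) * P = X ∧ P * (O ⊗ₖ (1 : Matrix b b ℂ)) = X := by
  refine exists_congr fun O => and_congr_right fun _ => ?_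
  rw [← Matrix.conjTranspose_inj, Matrix.conjTranspose_mul, Matrix.conjTranspose_conjTranspose,
    Matrix.conjTranspose_kronecker, Matrix.conjTranspose_conjTranspose,
    Matrix.conjTranspose_one, hP]

theorem mem_codeSubalgebraB_iff {P : Matrix (a × b) (a × b) ℂ} (hP : Pᴴ = P)
    {X : Matrix (a × b) (a × b) ℂ} :
    X ∈ codeSubalgebraB P ↔ ∃ O : Matrix b b ℂ,
      ((1 : Matrix a a ℂ) ⊗ₖ O) * P = X ∧ P * ((1 : Matrix a a ℂ) ⊗ₖ O) = X := by
  refine exists_congr fun O => and_congr_right fun _ => ?_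
  rw [← Matrix.conjTranspose_inj, Matrix.conjTranspose_mul, Matrix.conjTranspose_conjTranspose,
    Matrix.conjTranspose_kronecker, Matrix.conjTranspose_conjTranspose,
    Matrix.conjTranspose_one, hP]

theorem kronecker_one_mul_one_kronecker (O : Matrix a a ℂ) (O' : Matrix b b ℂ) :
    (O ⊗ₖ (1 : Matrix b b ℂ)) * ((1 : Matrix a a ℂ) ⊗ₖ O')
      = ((1 : Matrix a a ℂ) ⊗ₖ O') * (O ⊗ₖ (1 : Matrix b b ℂ)) := by
  rw [← Matrix.mul_kronecker_mul, ← Matrix.mul_kronecker_mul]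
  simp

variable {P : Matrix (a × b) (a × b) ℂ}

theorem mul_eq_of_mem_codeSubalgebraA (hP : Pᴴ = P) (hPi : P * P = P)
    {X : Matrix (a × b) (a × b) ℂ} (hX : X ∈ codeSubalgebraA P) : P * X = X ∧ X * P = X := by
  obtain ⟨O, h1, h2⟩ := (mem_codeSubalgebraA_iff hP).1 hX
  constructor
  · rw [← h2, ← mul_assoc, hPi]
  · rw [← h1, mul_assoc, hPi]

theorem mul_eq_of_mem_codeSubalgebraB (hP : Pᴴ = P) (hPi : P * P = P)
    {X : Matrix (a × b) (a × b) ℂ} (hX : X ∈ codeSubalgebraB P) : P * X = X ∧ X * P = X := by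
  obtain ⟨O, h1, h2⟩ := (mem_codeSubalgebraB_iff hP).1 hX
  constructor
  · rw [← h2, ← mul_assoc, hPi]
  · rw [← h1, mul_assoc, hPi]

theorem commute_codeSubalgebras (hP : Pᴴ = P) (hPi : P * P = P)
    {X Y : Matrix (a × b) (a × b) ℂ} (hX : X ∈ codeSubalgebraA P)
    (hY : Y ∈ codeSubalgebraB P) : X * Y = Y * X := by
  obtain ⟨O, h1, h2⟩ := (mem_codeSubalgebraA_iff hP).1 hX
  obtain ⟨O', h1', h2'⟩ := (mem_codeSubalgebraB_iff hP).1 hY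
  calc X * Y = (O ⊗ₖ (1 : Matrix b b ℂ)) * ((1 : Matrix a a ℂ) ⊗ₖ O') * P := by
        rw [← h1, mul_assoc, (mul_eq_of_mem_codeSubalgebraB hP hPi hY).1, ← h1', mul_assoc]
    _ = ((1 : Matrix a a ℂ) ⊗ₖ O') * (O ⊗ₖ (1 : Matrix b b ℂ)) * P := by
        rw [kronecker_one_mul_one_kronecker]
    _ = Y * X := by
        rw [← h1', mul_assoc _ P X, (mul_eq_of_mem_codeSubalgebraA hP hPi hX).1, ← h1, mul_assoc]

/-- The code subalgebra `M_A` as a star-subalgebra; its unit is the code projector. -/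
def codeStarSubalgebraA (P : Matrix (a × b) (a × b) ℂ) (hP : Pᴴ = P) (hPi : P * P = P) :
    NonUnitalStarSubalgebra ℂ (Matrix (a × b) (a × b) ℂ) where
  carrier := codeSubalgebraA P
  zero_mem' := (mem_codeSubalgebraA_iff hP).2 ⟨0, by simp⟩
  add_mem' := by
    rintro X Y ⟨O, h1, h2⟩ ⟨O', h1', h2'⟩
    refine ⟨O + O', ?_, ?_⟩
    · rw [Matrix.add_kronecker, add_mul, h1, h1']
    · rw [Matrix.conjTranspose_add, Matrix.add_kronecker, add_mul, h2, h2',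
        Matrix.conjTranspose_add]
  mul_mem' := by
    intro X Y hX hY
    obtain ⟨O, h1, h2⟩ := (mem_codeSubalgebraA_iff hP).1 hX
    obtain ⟨O', h1', h2'⟩ := (mem_codeSubalgebraA_iff hP).1 hY
    have hk : ((O * O') ⊗ₖ (1 : Matrix b b ℂ))
        = (O ⊗ₖ (1 : Matrix b b ℂ)) * (O' ⊗ₖ (1 : Matrix b b ℂ)) := by
      rw [← Matrix.mul_kronecker_mul, one_mul]
    refine (mem_codeSubalgebraA_iff hP).2 ⟨O * O', ?_, ?_⟩
    · rw [hk, mul_assoc, h1', ← (mul_eq_of_mem_codeSubalgebraA hP hPi hY).1, ← mul_assoc, h1,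
        (mul_eq_of_mem_codeSubalgebraA hP hPi hY).1]
    · rw [hk, ← mul_assoc, h2, ← (mul_eq_of_mem_codeSubalgebraA hP hPi hX).2, mul_assoc, h2',
        (mul_eq_of_mem_codeSubalgebraA hP hPi hX).2]
  smul_mem' := by
    rintro z X ⟨O, h1, h2⟩
    refine ⟨z • O, ?_, ?_⟩
    · rw [Matrix.smul_kronecker, Matrix.smul_mul, h1]
    · rw [Matrix.conjTranspose_smul, Matrix.smul_kronecker, Matrix.smul_mul, h2,
        Matrix.conjTranspose_smul]
  star_mem' := by
    rintro X ⟨O, h1, h2⟩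
    refine ⟨Oᴴ, h2, ?_⟩
    rw [Matrix.conjTranspose_conjTranspose, h1]
    exact (Matrix.conjTranspose_conjTranspose X).symm

theorem sum_mem_codeSubalgebraB {ι : Type*} [Fintype ι] {X : ι → Matrix (a × b) (a × b) ℂ}
    (hX : ∀ i, X i ∈ codeSubalgebraB P) : ∑ i, X i ∈ codeSubalgebraB P := by
  refine Finset.sum_induction X (· ∈ codeSubalgebraB P) ?_ ⟨0, by simp⟩ fun i _ => hX i
  rintro X Y ⟨O, h1, h2⟩ ⟨O', h1', h2'⟩
  refine ⟨O + O', ?_, ?_⟩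
  · rw [Matrix.kronecker_add, add_mul, h1, h1']
  · rw [Matrix.conjTranspose_add, Matrix.kronecker_add, add_mul, h2, h2',
      Matrix.conjTranspose_add]

/-- A product operator carries a vector `v`, read as the matrix with entries `v (x, y)`, to the
matrix product with `O` on the left and the transpose of `O'` on the right. -/
theorem kronecker_mulVec (O : Matrix a a ℂ) (O' : Matrix b b ℂ) (v : a × b → ℂ) (x : a) (y : b) :
    ((O ⊗ₖ O') *ᵥ v) (x, y) = ∑ x', ∑ y', O x x' * O' y y' * v (x', y') := by
  simp only [Matrix.mulVec, dotProduct, Fintype.sum_prod_type, Matrix.kronecker_apply]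

end CodeSubalgebra

/-! ### Rank-one operators -/

section KetBra

variable {c : Type*} [Fintype c]

theorem mul_ketBra (X : Matrix c c ℂ) (u v : c → ℂ) : X * ketBra u v = ketBra (X *ᵥ u) v := by
  rw [ketBra, ketBra, Matrix.mul_vecMulVec]

theorem ketBra_mul (X : Matrix c c ℂ) (u v : c → ℂ) :
    ketBra u v * X = ketBra u (Xᴴ *ᵥ v) := by
  rw [ketBra, ketBra, Matrix.vecMulVec_mul, Matrix.star_mulVec, Matrix.conjTranspose_conjTranspose]

theorem ketBra_mulVec (u v w : c → ℂ) : ketBra u v *ᵥ w = (star v ⬝ᵥ w) • u := by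
  rw [ketBra, Matrix.vecMulVec_mulVec, op_smul_eq_smul]

theorem ketBra_mul_ketBra (u v u' v' : c → ℂ) :
    ketBra u v * ketBra u' v' = (star v ⬝ᵥ u') • ketBra u v' := by
  rw [mul_ketBra, ketBra_mulVec, ketBra, ketBra, Matrix.smul_vecMulVec]

theorem conjTranspose_ketBra (u v : c → ℂ) : (ketBra u v)ᴴ = ketBra v u := by
  rw [ketBra, ketBra, Matrix.conjTranspose_vecMulVec, star_star]

theorem zero_ketBra (v : c → ℂ) : ketBra 0 v = 0 := by
  rw [ketBra, Matrix.zero_vecMulVec]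

theorem trace_ketBra (u v : c → ℂ) : (ketBra u v).trace = star v ⬝ᵥ u := by
  rw [ketBra, Matrix.trace_vecMulVec, dotProduct_comm]

end KetBra

/-! ### Existence of a complementary recovery -/

section Amplify

variable {c : Type*} [Fintype c] [DecidableEq c]
  {M : NonUnitalStarSubalgebra ℂ (Matrix c c ℂ)} {P : Matrix c c ℂ}

namespace MatrixUnits

variable (D : MatrixUnits M P)

theorem q_mul_conj (α : D.Sector) (i : D.A₁ α) : D.q α * (D.u α i)ᴴ = (D.u α i)ᴴ := by
  conv_lhs => rw [← D.q_herm]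
  rw [← Matrix.conjTranspose_mul, D.u_mul_q]

theorem q_mem (α : D.Sector) : D.q α ∈ M := by
  obtain ⟨i⟩ := D.nonempty α
  rw [← D.conj_mul_self α i]
  exact mul_mem (star_mem (D.u_mem α i)) (D.u_mem α i)

/-- The operator `1 ⊗ K` on the block `α`, for an operator `K` on the range of `q α`. -/
def amplify (α : D.Sector) (K : Matrix c c ℂ) : Matrix c c ℂ :=
  ∑ i, D.u α i * K * (D.u α i)ᴴ

theorem conjTranspose_amplify (α : D.Sector) (K : Matrix c c ℂ) :
    (D.amplify α K)ᴴ = D.amplify α Kᴴ := by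
  rw [amplify, amplify, Matrix.conjTranspose_sum]
  refine Finset.sum_congr rfl fun i _ => ?_
  rw [Matrix.conjTranspose_mul, Matrix.conjTranspose_mul, Matrix.conjTranspose_conjTranspose,
    mul_assoc]

theorem conj_mul_amplify_of_ne {α β : D.Sector} (h : β ≠ α) (i : D.A₁ β) (K : Matrix c c ℂ) :
    (D.u β i)ᴴ * D.amplify α K = 0 := by
  rw [amplify, Finset.mul_sum]
  refine Finset.sum_eq_zero fun k _ => ?_
  rw [← mul_assoc, ← mul_assoc, D.conj_mul_of_sector_ne β α i k h, zero_mul, zero_mul]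

theorem conj_mul_amplify (α : D.Sector) (i : D.A₁ α) {K : Matrix c c ℂ} (hK : D.q α * K = K) :
    (D.u α i)ᴴ * D.amplify α K = K * (D.u α i)ᴴ := by
  rw [amplify, Finset.mul_sum, Finset.sum_eq_single i]
  · rw [← mul_assoc, ← mul_assoc, D.conj_mul_self, hK]
  · intro k _ hk
    rw [← mul_assoc, ← mul_assoc, D.conj_mul_of_ne α i k hk.symm, zero_mul, zero_mul]
  · simp

theorem amplify_mul_of_ne {α β : D.Sector} (h : β ≠ α) (i : D.A₁ β) (K : Matrix c c ℂ) :
    D.amplify α K * D.u β i = 0 := by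
  rw [← Matrix.conjTranspose_inj, Matrix.conjTranspose_mul, conjTranspose_amplify,
    D.conj_mul_amplify_of_ne h, Matrix.conjTranspose_zero]

theorem amplify_mul (α : D.Sector) (i : D.A₁ α) {K : Matrix c c ℂ} (hK : K * D.q α = K) :
    D.amplify α K * D.u α i = D.u α i * K := by
  have hK' : D.q α * Kᴴ = Kᴴ := by
    conv_lhs => rw [← D.q_herm]
    rw [← Matrix.conjTranspose_mul, hK]
  rw [← Matrix.conjTranspose_inj, Matrix.conjTranspose_mul, conjTranspose_amplify,
    D.conj_mul_amplify α i hK', Matrix.conjTranspose_mul]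

theorem commute_amplify (α : D.Sector) {K : Matrix c c ℂ} (hl : D.q α * K = K)
    (hr : K * D.q α = K) {X : Matrix c c ℂ} (hX : X ∈ M) :
    D.amplify α K * X = X * D.amplify α K := by
  obtain ⟨O, rfl⟩ := D.span X hX
  simp only [Finset.mul_sum, Finset.sum_mul]
  refine Finset.sum_congr rfl fun β _ => Finset.sum_congr rfl fun i _ =>
    Finset.sum_congr rfl fun j _ => ?_
  rw [Matrix.mul_smul, Matrix.smul_mul, ← mul_assoc, mul_assoc]
  by_cases h : β = α
  · subst h
    rw [← mul_assoc, D.amplify_mul β i hr, mul_assoc (D.u β i) (D.u β j)ᴴ,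
      D.conj_mul_amplify β j hl, mul_assoc]
  · rw [← mul_assoc, D.amplify_mul_of_ne h, mul_assoc (D.u β i) (D.u β j)ᴴ,
      D.conj_mul_amplify_of_ne h, zero_mul, mul_zero]

theorem amplify_mul_q (α : D.Sector) {K : Matrix c c ℂ} (hl : D.q α * K = K)
    (hr : K * D.q α = K) : D.amplify α K * D.q α = K := by
  obtain ⟨i⟩ := D.nonempty α
  rw [← D.conj_mul_self α i, ← mul_assoc,
    D.commute_amplify α hl hr (X := (D.u α i)ᴴ) (star_mem (D.u_mem α i)), mul_assoc,
    D.amplify_mul α i hr, ← mul_assoc, D.conj_mul_self, hl]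

theorem amplify_mul_q_of_ne {α β : D.Sector} (h : β ≠ α) {K : Matrix c c ℂ}
    (hl : D.q α * K = K) (hr : K * D.q α = K) : D.amplify α K * D.q β = 0 := by
  obtain ⟨i⟩ := D.nonempty β
  rw [← D.conj_mul_self β i, ← mul_assoc,
    D.commute_amplify α hl hr (X := (D.u β i)ᴴ) (star_mem (D.u_mem β i)), mul_assoc,
    D.amplify_mul_of_ne h, mul_zero]

/-- An operator commuting with `M` is the sum of the amplifications of its compressions. -/
theorem eq_sum_amplify {Y : Matrix c c ℂ} (hYP : Y * P = Y) (hY : ∀ X ∈ M, X * Y = Y * X) :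
    Y = ∑ α, D.amplify α (D.q α * Y * D.q α) := by
  conv_lhs => rw [← hYP, ← D.sum_eq, Finset.mul_sum]
  refine Finset.sum_congr rfl fun α _ => ?_
  rw [amplify, Finset.mul_sum]
  refine Finset.sum_congr rfl fun i _ => ?_
  rw [← mul_assoc, ← hY _ (D.u_mem α i)]
  calc D.u α i * Y * (D.u α i)ᴴ = (D.u α i * D.q α) * Y * (D.q α * (D.u α i)ᴴ) := by
        rw [D.u_mul_q, D.q_mul_conj]
    _ = _ := by noncomm_ring

end MatrixUnits

end Amplify

section Isometry

variable {a b : Type*} [Fintype a] [DecidableEq a] [Fintype b]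

/-- Operators `O α i` that send the ranges of the matrices `V α` isometrically onto pairwise
orthogonal subspaces carry orthonormal families in these ranges to an orthonormal family. -/
theorem isometry_of_lifts {Sector : Type} {I : Sector → Type} {r : Sector → ℕ}
    [Fintype Sector] [∀ α, Fintype (I α)] [DecidableEq Sector] [∀ α, DecidableEq (I α)]
    (V : Sector → Matrix a b ℂ) (O : ∀ α, I α → Matrix a a ℂ)
    (v : ∀ α, Fin (r α) → a → ℂ) (g : ∀ α, Fin (r α) → b → ℂ)
    (hv : ∀ α k l, star (v α k) ⬝ᵥ v α l = if k = l then 1 else 0)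
    (hg : ∀ α k, v α k = V α *ᵥ g α k)
    (h1 : ∀ α i, (O α i)ᴴ * O α i * V α = V α)
    (h2 : ∀ α i j, i ≠ j → (O α i)ᴴ * O α j * V α = 0)
    (h3 : ∀ α β i j, α ≠ β → (O α i)ᴴ * O β j * V β = 0) :
    (Matrix.of fun x (t : Σ α, I α × Fin (r α)) => (O t.1 t.2.1 *ᵥ v t.1 t.2.2) x)ᴴ
      * (Matrix.of fun x (t : Σ α, I α × Fin (r α)) => (O t.1 t.2.1 *ᵥ v t.1 t.2.2) x) = 1 := by
  have key : ∀ α β i j k l, star (O α i *ᵥ v α k) ⬝ᵥ (O β j *ᵥ v β l)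
      = star (v α k) ⬝ᵥ (((O α i)ᴴ * O β j * V β) *ᵥ g β l) := by
    intro α β i j k l
    rw [hg β l, Matrix.star_mulVec, ← Matrix.dotProduct_mulVec, Matrix.mulVec_mulVec,
      Matrix.mulVec_mulVec, Matrix.mul_assoc]
  ext ⟨α, i, k⟩ ⟨β, j, l⟩
  have hentry : ((Matrix.of fun x (t : Σ α, I α × Fin (r α)) => (O t.1 t.2.1 *ᵥ v t.1 t.2.2) x)ᴴ
      * (Matrix.of fun x (t : Σ α, I α × Fin (r α)) => (O t.1 t.2.1 *ᵥ v t.1 t.2.2) x))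
      ⟨α, i, k⟩ ⟨β, j, l⟩ = star (O α i *ᵥ v α k) ⬝ᵥ (O β j *ᵥ v β l) := rfl
  rw [hentry, key]
  by_cases hαβ : α = β
  · subst hαβ
    by_cases hij : i = j
    · subst hij
      rw [h1, ← hg, hv, Matrix.one_apply]
      by_cases hkl : k = l
      · simp [hkl]
      · rw [if_neg hkl, if_neg]
        intro h
        simp only [Sigma.mk.injEq, heq_eq_eq, Prod.mk.injEq, true_and] at h
        exact hkl h
    · rw [h2 α i j hij, Matrix.zero_mulVec, dotProduct_zero, Matrix.one_apply_ne]
      intro h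
      simp only [Sigma.mk.injEq, heq_eq_eq, Prod.mk.injEq, true_and] at h
      exact hij h.1
  · rw [h3 α β i j hαβ, Matrix.zero_mulVec, dotProduct_zero, Matrix.one_apply_ne]
    intro h
    exact hαβ (congrArg Sigma.fst h)

/-- The Schmidt coefficients of a unit vector have square sum `1`. -/
theorem sum_sq_schmidt {r : ℕ} {V : a × b → ℂ} {s : Fin r → ℝ} {v : Fin r → a → ℂ}
    {w : Fin r → b → ℂ} (hv : ∀ k l, star (v k) ⬝ᵥ v l = if k = l then 1 else 0)
    (hw : ∀ k l, star (w k) ⬝ᵥ w l = if k = l then 1 else 0)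
    (hV : ∀ x y, V (x, y) = ∑ k, (s k : ℂ) * v k x * w k y) (h1 : star V ⬝ᵥ V = 1) :
    ∑ k, s k ^ 2 = 1 := by
  have swap : ∀ F : a → b → Fin r → Fin r → ℂ,
      ∑ x, ∑ y, ∑ k, ∑ l, F x y k l = ∑ k, ∑ l, ∑ x, ∑ y, F x y k l := fun F => by
    calc _ = ∑ x, ∑ k, ∑ l, ∑ y, F x y k l := Finset.sum_congr rfl fun x _ => by
          rw [Finset.sum_comm]
          exact Finset.sum_congr rfl fun k _ => Finset.sum_comm
      _ = ∑ k, ∑ x, ∑ l, ∑ y, F x y k l := Finset.sum_comm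
      _ = _ := Finset.sum_congr rfl fun k _ => Finset.sum_comm
  have : star V ⬝ᵥ V = ((∑ k, s k ^ 2 : ℝ) : ℂ) := by
    calc star V ⬝ᵥ V = ∑ x, ∑ y, (∑ k, (s k : ℂ) * star (v k x) * star (w k y))
          * (∑ l, (s l : ℂ) * v l x * w l y) := by
          simp only [dotProduct, Fintype.sum_prod_type, Pi.star_apply, hV, star_sum, star_mul',
            Complex.star_def, Complex.conj_ofReal]
      _ = ∑ k, ∑ l, (s k : ℂ) * (s l : ℂ) * (star (v k) ⬝ᵥ v l) * (star (w k) ⬝ᵥ w l) := by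
          simp_rw [Finset.sum_mul_sum]
          rw [swap]
          refine Finset.sum_congr rfl fun k _ => Finset.sum_congr rfl fun l _ => ?_
          simp only [dotProduct, Pi.star_apply]
          rw [mul_assoc, Finset.sum_mul_sum, Finset.mul_sum]
          refine Finset.sum_congr rfl fun x _ => ?_
          rw [Finset.mul_sum]
          exact Finset.sum_congr rfl fun y _ => by ring
      _ = _ := by
          simp [hv, hw, sq]
  rw [h1] at this
  exact_mod_cast this.symm

end Isometry

section Existence

variable {a b : Type*} [Fintype a] [DecidableEq a] [Fintype b] [DecidableEq b]

theorem kronecker_one_mulVec (O : Matrix a a ℂ) (v : a × b → ℂ) (x : a) (y : b) :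
    ((O ⊗ₖ (1 : Matrix b b ℂ)) *ᵥ v) (x, y) = (O * Matrix.of fun x y => v (x, y)) x y := by
  rw [kronecker_mulVec, Matrix.mul_apply]
  refine Finset.sum_congr rfl fun x' _ => ?_
  simp [Matrix.one_apply]

theorem one_kronecker_mulVec (O : Matrix b b ℂ) (v : a × b → ℂ) (x : a) (y : b) :
    (((1 : Matrix a a ℂ) ⊗ₖ O) *ᵥ v) (x, y) = (O * (Matrix.of fun x y => v (x, y))ᵀ) y x := by
  rw [kronecker_mulVec, Matrix.mul_apply, Finset.sum_comm]
  refine Finset.sum_congr rfl fun y' _ => ?_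
  simp [Matrix.one_apply]

/-- If the commutant of `M_A` on the code is contained in `M_Ā`, the code has a complementary
recovery. The codewords are `u α i (f α j)`, for matrix units `u` of `M_A` and an orthonormal basis
`f α` of the range of `q α`. The operators on `H_A` that lift the `u α i`, and those on `H_Ā` that
lift the operators changing `j`, create all codewords of the block `α` from a single one; applied to
the two sides of the Schmidt decomposition of that one, they give the isometries. -/
theorem nonempty_complementaryRecovery {P : Matrix (a × b) (a × b) ℂ} (hP : Pᴴ = P)
    (hPi : P * P = P)
    (hcomm : ∀ Y, P * Y = Y → Y * P = Y → (∀ X ∈ codeSubalgebraA P, X * Y = Y * X) →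
      Y ∈ codeSubalgebraB P) : Nonempty (ComplementaryRecovery P) := by
  classical
  have hPM : P ∈ codeStarSubalgebraA P hP hPi := (mem_codeSubalgebraA_iff hP).2 ⟨1, by simp⟩
  have hPl : ∀ X ∈ codeStarSubalgebraA P hP hPi, P * X = X := fun X hX =>
    (mul_eq_of_mem_codeSubalgebraA hP hPi hX).1
  have hPr : ∀ X ∈ codeStarSubalgebraA P hP hPi, X * P = X := fun X hX =>
    (mul_eq_of_mem_codeSubalgebraA hP hPi hX).2
  obtain ⟨D⟩ := exists_matrixUnits (codeStarSubalgebraA P hP hPi) hPM hP hPi hPl hPr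
  choose m f hf hq using fun α => exists_orthonormal_of_projection (D.q_herm α) (D.q_idem α)
  have hqf : ∀ α j, D.q α *ᵥ f α j = f α j := fun α j => by
    conv_lhs => rw [hq α]
    rw [Matrix.sum_mulVec]
    simp [ketBra_mulVec, hf]
  have hPf : ∀ α j, P *ᵥ f α j = f α j := fun α j => by
    rw [← hqf α j, Matrix.mulVec_mulVec, hPl _ (D.q_mem α)]
  have hne : ∀ α, Nonempty (Fin (m α)) := fun α => by
    by_contra h
    rw [not_nonempty_iff] at h
    exact D.q_ne_zero α (by rw [hq α]; simp)
  let j₀ : ∀ α, Fin (m α) := fun α => (hne α).some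
  -- The operators `|f j⟩⟨f j'|` on the range of `q α`.
  have hql : ∀ α j j', D.q α * ketBra (f α j) (f α j') = ketBra (f α j) (f α j') :=
    fun α j j' => by rw [mul_ketBra, hqf]
  have hqr : ∀ α j j', ketBra (f α j) (f α j') * D.q α = ketBra (f α j) (f α j') :=
    fun α j j' => by rw [ketBra_mul, D.q_herm, hqf]
  have hampB : ∀ α K, D.q α * K = K → K * D.q α = K → D.amplify α K ∈ codeSubalgebraB P := by
    intro α K hl hr
    have hc : ∀ X ∈ codeStarSubalgebraA P hP hPi, D.amplify α K * X = X * D.amplify α K :=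
      fun X hX => D.commute_amplify α hl hr hX
    have hl' : P * D.amplify α K = D.amplify α K := by
      rw [MatrixUnits.amplify, Finset.mul_sum]
      refine Finset.sum_congr rfl fun i _ => ?_
      rw [← mul_assoc, ← mul_assoc, hPl _ (D.u_mem α i)]
    exact hcomm _ hl' (by rw [hc P hPM, hl']) fun X hX => (hc X hX).symm
  -- Lifts to `H_A` of the partial isometries `u`, and to `H_Ā` of the operators changing `j`.
  choose OA hA1 hA2 using fun (t : Σ α, D.A₁ α) =>
    (mem_codeSubalgebraA_iff hP).1 (D.u_mem t.1 t.2)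
  choose OB hB1 hB2 using fun (t : Σ α, Fin (m α)) =>
    (mem_codeSubalgebraB_iff hP).1 (hampB t.1 _ (hql t.1 t.2 (j₀ t.1)) (hqr t.1 t.2 (j₀ t.1)))
  have hAf : ∀ α i β j, (OA ⟨α, i⟩ ⊗ₖ (1 : Matrix b b ℂ)) *ᵥ f β j = D.u α i *ᵥ f β j := by
    intro α i β j
    conv_lhs => rw [← hPf β j]
    rw [Matrix.mulVec_mulVec, hA1]
  have hA3 : ∀ α i, ((OA ⟨α, i⟩)ᴴ ⊗ₖ (1 : Matrix b b ℂ)) * P = (D.u α i)ᴴ := by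
    intro α i
    have := congrArg Matrix.conjTranspose (hA2 ⟨α, i⟩)
    rwa [Matrix.conjTranspose_mul, Matrix.conjTranspose_kronecker, Matrix.conjTranspose_one,
      hP] at this
  have hB3 : ∀ α j, ((1 : Matrix a a ℂ) ⊗ₖ (OB ⟨α, j⟩)ᴴ) * P
      = D.amplify α (ketBra (f α (j₀ α)) (f α j)) := by
    intro α j
    have := congrArg Matrix.conjTranspose (hB2 ⟨α, j⟩)
    rwa [Matrix.conjTranspose_mul, Matrix.conjTranspose_kronecker, Matrix.conjTranspose_one,
      hP, D.conjTranspose_amplify, conjTranspose_ketBra] at this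
  have hamp : ∀ α j j' k, D.amplify α (ketBra (f α j) (f α j')) *ᵥ f α k
      = if j' = k then f α j else 0 := by
    intro α j j' k
    conv_lhs => rw [← hqf α k]
    rw [Matrix.mulVec_mulVec, D.amplify_mul_q α (hql α j j') (hqr α j j'), ketBra_mulVec, hf]
    split_ifs <;> simp
  have hamp' : ∀ α β j j' k, α ≠ β →
      D.amplify α (ketBra (f α j) (f α j')) *ᵥ f β k = 0 := by
    intro α β j j' k h
    conv_lhs => rw [← hqf β k]
    rw [Matrix.mulVec_mulVec, D.amplify_mul_q_of_ne h.symm (hql α j j') (hqr α j j'),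
      Matrix.zero_mulVec]
  have hBf : ∀ α j, ((1 : Matrix a a ℂ) ⊗ₖ OB ⟨α, j⟩) *ᵥ f α (j₀ α) = f α j := by
    intro α j
    conv_lhs => rw [← hPf α (j₀ α)]
    rw [Matrix.mulVec_mulVec, hB1, hamp, if_pos rfl]
  let V : ∀ α, Matrix a b ℂ := fun α => Matrix.of fun x y => f α (j₀ α) (x, y)
  have hAA : ∀ α β i j x y, ((OA ⟨α, i⟩)ᴴ * OA ⟨β, j⟩ * V β) x y
      = (((D.u α i)ᴴ * D.u β j) *ᵥ f β (j₀ β)) (x, y) := by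
    intro α β i j x y
    rw [← kronecker_one_mulVec, ← hA3, mul_assoc, hPl _ (D.u_mem β j), ← Matrix.mulVec_mulVec,
      ← hAf, Matrix.mulVec_mulVec, ← Matrix.mul_kronecker_mul, one_mul]
  have hBB : ∀ α β i j y x, ((OB ⟨α, i⟩)ᴴ * OB ⟨β, j⟩ * (V β)ᵀ) y x
      = (D.amplify α (ketBra (f α (j₀ α)) (f α i)) *ᵥ f β j) (x, y) := by
    intro α β i j y x
    rw [← one_kronecker_mulVec, ← hB3, ← Matrix.mulVec_mulVec, hPf, ← hBf β j,
      Matrix.mulVec_mulVec, ← Matrix.mul_kronecker_mul, one_mul]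
  choose r s vA gB vB gA hvA hvB hV hvA' hvB' using fun α => exists_schmidt (V α)
  let WA : Matrix a (Σ α, D.A₁ α × Fin (r α)) ℂ :=
    Matrix.of fun x t => (OA ⟨t.1, t.2.1⟩ *ᵥ vA t.1 t.2.2) x
  let WB : Matrix b (Σ α, Fin (m α) × Fin (r α)) ℂ :=
    Matrix.of fun x t => (OB ⟨t.1, t.2.1⟩ *ᵥ vB t.1 t.2.2) x
  let χ : ∀ α, Fin (r α) × Fin (r α) → ℂ := fun α t => if t.1 = t.2 then (s α t.1 : ℂ) else 0
  have hcw : ∀ α i j, codeword WA WB χ α i j = D.u α i *ᵥ f α j := by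
    intro α i j
    have hfj : D.u α i *ᵥ f α j = (OA ⟨α, i⟩ ⊗ₖ OB ⟨α, j⟩) *ᵥ f α (j₀ α) := by
      rw [← hAf, ← hBf α j, Matrix.mulVec_mulVec, ← Matrix.mul_kronecker_mul, one_mul, mul_one]
    rw [hfj]
    ext ⟨x, y⟩
    have hVx : ∀ x y, f α (j₀ α) (x, y) = ∑ k, (s α k : ℂ) * vA α k x * vB α k y := hV α
    rw [kronecker_mulVec]
    have e1 : codeword WA WB χ α i j (x, y) = ∑ k, (∑ x', OA ⟨α, i⟩ x x' * vA α k x')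
        * (∑ y', OB ⟨α, j⟩ y y' * vB α k y') * s α k := by
      simp only [codeword, WA, WB, χ, Matrix.of_apply, mul_ite, mul_zero, Finset.sum_ite_eq,
        Finset.mem_univ, if_true]
      rfl
    rw [e1]
    simp_rw [hVx, Finset.sum_mul_sum, Finset.mul_sum, Finset.sum_mul]
    rw [Finset.sum_comm]
    refine Finset.sum_congr rfl fun x' _ => ?_
    rw [Finset.sum_comm]
    refine Finset.sum_congr rfl fun y' _ => Finset.sum_congr rfl fun k _ => ?_
    ring
  have hsum : ∀ α i i', ∑ j, ketBra (codeword WA WB χ α i j) (codeword WA WB χ α i' j)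
      = D.u α i * (D.u α i')ᴴ := by
    intro α i i'
    simp_rw [hcw]
    calc _ = D.u α i * D.q α * (D.u α i')ᴴ := by
          rw [hq α, Finset.mul_sum, Finset.sum_mul]
          refine Finset.sum_congr rfl fun j _ => ?_
          rw [mul_ketBra, ketBra_mul, Matrix.conjTranspose_conjTranspose]
      _ = _ := by rw [D.u_mul_q]
  refine ⟨{ Sector := D.Sector, A₁ := D.A₁, B₁ := fun α => Fin (m α),
            A₂ := fun α => Fin (r α), B₂ := fun α => Fin (r α),
            nonemptyA₁ := D.nonempty, nonemptyB₁ := hne,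
            WA := WA, WB := WB, χ := χ, isometryA := ?_, isometryB := ?_, normalized := ?_,
            basis := ?_, wedderburnA := ?_, wedderburnB := ?_ }⟩
  · refine isometry_of_lifts V (fun α i => OA ⟨α, i⟩) vA gA hvA hvA' ?_ ?_ ?_
    · intro α i
      ext x y
      rw [hAA, D.conj_mul_self, hqf]
      rfl
    · intro α i j hij
      ext x y
      rw [hAA, D.conj_mul_of_ne α i j hij, Matrix.zero_mulVec]
      rfl
    · intro α β i j hαβ
      ext x y
      rw [hAA, D.conj_mul_of_sector_ne α β i j hαβ, Matrix.zero_mulVec]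
      rfl
  · refine isometry_of_lifts (fun α => (V α)ᵀ) (fun α j => OB ⟨α, j⟩) vB gB hvB hvB' ?_ ?_ ?_
    · intro α i
      ext y x
      rw [hBB, hamp, if_pos rfl]
      rfl
    · intro α i j hij
      ext y x
      rw [hBB, hamp, if_neg hij]
      rfl
    · intro α β i j hαβ
      ext y x
      rw [hBB, hamp' _ _ _ _ _ hαβ]
      rfl
  · intro α
    have h1 := sum_sq_schmidt (hvA α) (hvB α) (V := f α (j₀ α)) (hV α)
      (by rw [hf, if_pos rfl])
    rw [← h1, Fintype.sum_prod_type]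
    refine Finset.sum_congr rfl fun k _ => ?_
    rw [Finset.sum_eq_single k]
    · simp [χ]
    · intro l _ hl
      simp [χ, hl.symm]
    · simp
  · simp_rw [hsum]
    exact D.sum_eq.symm
  · intro X
    have hform : ∀ O : ∀ α, Matrix (D.A₁ α) (D.A₁ α) ℂ,
        ∑ α, ∑ i, ∑ i', ∑ j, O α i i' •
          ketBra (codeword WA WB χ α i j) (codeword WA WB χ α i' j)
        = ∑ α, ∑ i, ∑ i', O α i i' • (D.u α i * (D.u α i')ᴴ) := by
      intro O
      simp_rw [← Finset.smul_sum, hsum]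
    constructor
    · intro hX
      obtain ⟨O, hO⟩ := D.span X hX
      exact ⟨O, by rw [hform]; exact hO⟩
    · rintro ⟨O, hO⟩
      rw [hO, hform]
      change _ ∈ codeStarSubalgebraA P hP hPi
      exact sum_mem fun α _ => sum_mem fun i _ => sum_mem fun i' _ => SMulMemClass.smul_mem _
        (mul_mem (D.u_mem α i) (star_mem (D.u_mem α i')))
  · intro Y
    have hform : ∀ O : ∀ α, Matrix (Fin (m α)) (Fin (m α)) ℂ,
        ∑ α, ∑ i, ∑ j, ∑ j', O α j j' •
          ketBra (codeword WA WB χ α i j) (codeword WA WB χ α i j')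
        = ∑ α, D.amplify α (∑ j, ∑ j', O α j j' • ketBra (f α j) (f α j')) := by
      intro O
      refine Finset.sum_congr rfl fun α _ => Finset.sum_congr rfl fun i _ => ?_
      simp_rw [hcw, Finset.mul_sum, Finset.sum_mul, Matrix.mul_smul, Matrix.smul_mul, mul_ketBra,
        ketBra_mul, Matrix.conjTranspose_conjTranspose]
    constructor
    · intro hY
      have hYP := mul_eq_of_mem_codeSubalgebraB hP hPi hY
      refine ⟨fun α => Matrix.of fun j j' => star (f α j) ⬝ᵥ (Y *ᵥ f α j'), ?_⟩
      rw [hform]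
      conv_lhs => rw [D.eq_sum_amplify hYP.2 fun X hX => commute_codeSubalgebras hP hPi hX hY]
      refine Finset.sum_congr rfl fun α _ => ?_
      congr 1
      rw [hq α, Finset.sum_mul, Finset.sum_mul]
      refine Finset.sum_congr rfl fun j _ => ?_
      rw [Finset.mul_sum]
      refine Finset.sum_congr rfl fun j' _ => ?_
      rw [mul_assoc, mul_ketBra, ketBra_mul_ketBra]
      rfl
    · rintro ⟨O, hO⟩
      rw [hO, hform]
      refine sum_mem_codeSubalgebraB fun α => hampB α _ ?_ ?_
      · simp_rw [Finset.mul_sum, Matrix.mul_smul, hql]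
      · simp_rw [Finset.sum_mul, Matrix.smul_mul, hqr]

end Existence

/-! ### The block structure of a complementary recovery -/

section Blocks

variable {a b : Type*} [Fintype a] [DecidableEq a] [Fintype b] [DecidableEq b]

namespace ComplementaryRecovery

variable {P : Matrix (a × b) (a × b) ℂ} (D : ComplementaryRecovery P)

/-- The codeword `|α,ij⟩` of the recovery. -/
abbrev word (α : D.Sector) (i : D.A₁ α) (j : D.B₁ α) : a × b → ℂ :=
  codeword D.WA D.WB D.χ α i j

/-- The restriction of `WA` to `|α,i⟩ ⊗ H_{A₂}`. -/
def colA (α : D.Sector) (i : D.A₁ α) : Matrix a (D.A₂ α) ℂ :=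
  Matrix.of fun x k => D.WA x ⟨α, i, k⟩

/-- The restriction of `WB` to `|α,j⟩ ⊗ H_{Ā₂}`. -/
def colB (α : D.Sector) (j : D.B₁ α) : Matrix b (D.B₂ α) ℂ :=
  Matrix.of fun y l => D.WB y ⟨α, j, l⟩

/-- The vector `|χ_α⟩` as a matrix. -/
def chiMat (α : D.Sector) : Matrix (D.A₂ α) (D.B₂ α) ℂ :=
  Matrix.of fun k l => D.χ α (k, l)

/-- The codeword `|α,ij⟩` as a matrix. -/
def wordMat (α : D.Sector) (i : D.A₁ α) (j : D.B₁ α) : Matrix a b ℂ :=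
  D.colA α i * D.chiMat α * (D.colB α j)ᵀ

theorem word_apply (α : D.Sector) (i : D.A₁ α) (j : D.B₁ α) (x : a) (y : b) :
    D.word α i j (x, y) = D.wordMat α i j x y := by
  simp only [word, codeword, wordMat, colA, colB, chiMat, Matrix.mul_apply, Matrix.of_apply,
    Matrix.transpose_apply, Finset.sum_mul]
  rw [Finset.sum_comm]
  exact Finset.sum_congr rfl fun _ _ => Finset.sum_congr rfl fun _ _ => by ring

theorem colA_same (α : D.Sector) (i : D.A₁ α) : (D.colA α i)ᴴ * D.colA α i = 1 := by
  ext k l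
  have := congrFun (congrFun D.isometryA ⟨α, i, k⟩) ⟨α, i, l⟩
  simp only [Matrix.one_apply, Sigma.mk.injEq, heq_eq_eq, Prod.mk.injEq, true_and] at this
  rw [Matrix.one_apply, ← this]
  rfl

theorem colA_of_ne (α : D.Sector) {i j : D.A₁ α} (h : i ≠ j) :
    (D.colA α i)ᴴ * D.colA α j = 0 := by
  ext k l
  have := congrFun (congrFun D.isometryA ⟨α, i, k⟩) ⟨α, j, l⟩
  simp only [Matrix.one_apply, Sigma.mk.injEq, heq_eq_eq, Prod.mk.injEq, true_and, h,
    false_and, if_false] at this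
  rw [Matrix.zero_apply, ← this]
  rfl

theorem colA_of_sector_ne {α β : D.Sector} (h : α ≠ β) (i : D.A₁ α) (j : D.A₁ β) :
    (D.colA α i)ᴴ * D.colA β j = 0 := by
  ext k l
  have := congrFun (congrFun D.isometryA ⟨α, i, k⟩) ⟨β, j, l⟩
  simp only [Matrix.one_apply, Sigma.mk.injEq, h, false_and, if_false] at this
  rw [Matrix.zero_apply, ← this]
  rfl

theorem colB_same (α : D.Sector) (i : D.B₁ α) : (D.colB α i)ᴴ * D.colB α i = 1 := by
  ext k l
  have := congrFun (congrFun D.isometryB ⟨α, i, k⟩) ⟨α, i, l⟩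
  simp only [Matrix.one_apply, Sigma.mk.injEq, heq_eq_eq, Prod.mk.injEq, true_and] at this
  rw [Matrix.one_apply, ← this]
  rfl

theorem colB_of_ne (α : D.Sector) {i j : D.B₁ α} (h : i ≠ j) :
    (D.colB α i)ᴴ * D.colB α j = 0 := by
  ext k l
  have := congrFun (congrFun D.isometryB ⟨α, i, k⟩) ⟨α, j, l⟩
  simp only [Matrix.one_apply, Sigma.mk.injEq, heq_eq_eq, Prod.mk.injEq, true_and, h,
    false_and, if_false] at this
  rw [Matrix.zero_apply, ← this]
  rfl

theorem star_word_dotProduct (α β : D.Sector) (i j i' j') :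
    star (D.word α i j) ⬝ᵥ D.word β i' j'
      = ((D.wordMat α i j)ᴴ * D.wordMat β i' j').trace := by
  simp only [dotProduct, Fintype.sum_prod_type, Pi.star_apply, word_apply, Matrix.trace,
    Matrix.diag_apply, Matrix.mul_apply, Matrix.conjTranspose_apply]
  exact Finset.sum_comm

theorem conjTranspose_wordMat_mul (α β : D.Sector) (i j i' j') :
    (D.wordMat α i j)ᴴ * D.wordMat β i' j' = ((D.colB α j)ᵀ)ᴴ *
      ((D.chiMat α)ᴴ * ((D.colA α i)ᴴ * D.colA β i') * D.chiMat β) * (D.colB β j')ᵀ := by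
  rw [wordMat, wordMat, Matrix.conjTranspose_mul, Matrix.conjTranspose_mul]
  simp only [Matrix.mul_assoc]

theorem transpose_colB_mul (α : D.Sector) (j j' : D.B₁ α) :
    (D.colB α j')ᵀ * ((D.colB α j)ᵀ)ᴴ = ((D.colB α j)ᴴ * D.colB α j')ᵀ := by
  rw [Matrix.transpose_mul]
  rfl

theorem word_orthonormal (α : D.Sector) (i i' : D.A₁ α) (j j' : D.B₁ α) :
    star (D.word α i j) ⬝ᵥ D.word α i' j' = if i = i' ∧ j = j' then 1 else 0 := by
  rw [star_word_dotProduct, conjTranspose_wordMat_mul]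
  by_cases hi : i = i'
  · subst hi
    rw [colA_same, Matrix.mul_one, Matrix.trace_mul_comm, ← Matrix.mul_assoc, transpose_colB_mul]
    by_cases hj : j = j'
    · subst hj
      rw [colB_same, Matrix.transpose_one, Matrix.one_mul, if_pos ⟨rfl, rfl⟩]
      have h1 := D.normalized α
      have h2 : ((D.chiMat α)ᴴ * D.chiMat α).trace = ((∑ x, ‖D.χ α x‖ ^ 2 : ℝ) : ℂ) := by
        simp only [Matrix.trace, Matrix.diag_apply, Matrix.mul_apply, Matrix.conjTranspose_apply,
          chiMat, Matrix.of_apply, Fintype.sum_prod_type]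
        rw [Finset.sum_comm]
        push_cast
        exact Finset.sum_congr rfl fun _ _ => Finset.sum_congr rfl fun _ _ =>
          Complex.conj_mul' _
      rw [h2, h1, Complex.ofReal_one]
    · rw [colB_of_ne D α hj, Matrix.transpose_zero, Matrix.zero_mul, Matrix.trace_zero,
        if_neg fun h => hj h.2]
  · rw [colA_of_ne D α hi, Matrix.mul_zero, Matrix.zero_mul, Matrix.mul_zero, Matrix.zero_mul,
      Matrix.trace_zero, if_neg fun h => hi h.1]

theorem word_orthogonal {α β : D.Sector} (h : α ≠ β) (i j i' j') :
    star (D.word α i j) ⬝ᵥ D.word β i' j' = 0 := by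
  rw [star_word_dotProduct, conjTranspose_wordMat_mul, colA_of_sector_ne D h, Matrix.mul_zero,
    Matrix.zero_mul, Matrix.mul_zero, Matrix.zero_mul, Matrix.trace_zero]

/-- The operator `O ⊗ 1` on the block `α`. -/
def blockA (α : D.Sector) : Matrix (D.A₁ α) (D.A₁ α) ℂ →ₗ[ℂ] Matrix (a × b) (a × b) ℂ where
  toFun O := ∑ i, ∑ i', ∑ j, O i i' • ketBra (D.word α i j) (D.word α i' j)
  map_add' O O' := by simp only [Matrix.add_apply, add_smul, Finset.sum_add_distrib]
  map_smul' z O := by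
    simp only [Matrix.smul_apply, smul_assoc, ← Finset.smul_sum, RingHom.id_apply]

/-- The operator `1 ⊗ O` on the block `α`. -/
def blockB (α : D.Sector) (O : Matrix (D.B₁ α) (D.B₁ α) ℂ) : Matrix (a × b) (a × b) ℂ :=
  ∑ i, ∑ j, ∑ j', O j j' • ketBra (D.word α i j) (D.word α i j')

theorem blockA_apply (α : D.Sector) (O : Matrix (D.A₁ α) (D.A₁ α) ℂ) :
    D.blockA α O = ∑ i, ∑ i', ∑ j, O i i' • ketBra (D.word α i j) (D.word α i' j) := rfl

theorem blockA_mulVec (α : D.Sector) (O : Matrix (D.A₁ α) (D.A₁ α) ℂ) (i : D.A₁ α)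
    (j : D.B₁ α) : D.blockA α O *ᵥ D.word α i j = ∑ i', O i' i • D.word α i' j := by
  simp only [blockA_apply, Matrix.sum_mulVec, Matrix.smul_mulVec, ketBra_mulVec,
    word_orthonormal]
  refine Finset.sum_congr rfl fun i' _ => ?_
  rw [Finset.sum_eq_single i, Finset.sum_eq_single j]
  · simp
  · intro k _ hk
    simp [hk]
  · simp
  · intro k _ hk
    simp [hk]
  · simp

theorem blockA_mulVec_of_ne {α β : D.Sector} (h : α ≠ β) (O : Matrix (D.A₁ α) (D.A₁ α) ℂ)
    (i : D.A₁ β) (j : D.B₁ β) : D.blockA α O *ᵥ D.word β i j = 0 := by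
  simp [blockA_apply, Matrix.sum_mulVec, Matrix.smul_mulVec, ketBra_mulVec,
    word_orthogonal D h]

theorem blockB_mulVec (α : D.Sector) (O : Matrix (D.B₁ α) (D.B₁ α) ℂ) (i : D.A₁ α)
    (j : D.B₁ α) : D.blockB α O *ᵥ D.word α i j = ∑ j', O j' j • D.word α i j' := by
  simp only [blockB, Matrix.sum_mulVec, Matrix.smul_mulVec, ketBra_mulVec,
    word_orthonormal]
  rw [Finset.sum_eq_single i]
  · refine Finset.sum_congr rfl fun j' _ => ?_
    rw [Finset.sum_eq_single j]
    · simp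
    · intro k _ hk
      simp [hk]
    · simp
  · intro k _ hk
    simp [hk]
  · simp

theorem blockB_mulVec_of_ne {α β : D.Sector} (h : α ≠ β) (O : Matrix (D.B₁ α) (D.B₁ α) ℂ)
    (i : D.A₁ β) (j : D.B₁ β) : D.blockB α O *ᵥ D.word β i j = 0 := by
  simp [blockB, Matrix.sum_mulVec, Matrix.smul_mulVec, ketBra_mulVec,
    word_orthogonal D h]

theorem mem_codeSubalgebraA_iff_blocks {X : Matrix (a × b) (a × b) ℂ} :
    X ∈ codeSubalgebraA P ↔ ∃ O : ∀ α, Matrix (D.A₁ α) (D.A₁ α) ℂ,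
      X = ∑ α, D.blockA α (O α) := D.wedderburnA X

theorem mem_codeSubalgebraB_iff_blocks {X : Matrix (a × b) (a × b) ℂ} :
    X ∈ codeSubalgebraB P ↔ ∃ O : ∀ α, Matrix (D.B₁ α) (D.B₁ α) ℂ,
      X = ∑ α, D.blockB α (O α) := D.wedderburnB X

theorem blockIdentity_eq_blockA (α : D.Sector) : D.blockIdentity α = D.blockA α 1 := by
  rw [blockIdentity, blockA_apply]
  refine Finset.sum_congr rfl fun i _ => ?_
  rw [Finset.sum_eq_single i]
  · simp
  · intro k _ hk
    simp [Matrix.one_apply_ne hk.symm]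
  · simp

theorem blockIdentity_eq_blockB (α : D.Sector) : D.blockIdentity α = D.blockB α 1 := by
  rw [blockIdentity, blockB]
  refine Finset.sum_congr rfl fun i _ => Finset.sum_congr rfl fun j _ => ?_
  rw [Finset.sum_eq_single j]
  · simp
  · intro k _ hk
    simp [Matrix.one_apply_ne hk.symm]
  · simp

theorem sum_blockIdentity : ∑ α, D.blockIdentity α = P := D.basis.symm

theorem sum_blockA_single (α : D.Sector) (O : Matrix (D.A₁ α) (D.A₁ α) ℂ) :
    ∑ β, D.blockA β (Pi.single (M := fun β => Matrix (D.A₁ β) (D.A₁ β) ℂ) α O β)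
      = D.blockA α O := by
  rw [Finset.sum_eq_single α]
  · rw [Pi.single_eq_same]
  · intro β _ h
    rw [Pi.single_eq_of_ne h, map_zero]
  · simp

theorem blockA_mem (α : D.Sector) (O : Matrix (D.A₁ α) (D.A₁ α) ℂ) :
    D.blockA α O ∈ codeSubalgebraA P :=
  D.mem_codeSubalgebraA_iff_blocks.2 ⟨_, (D.sum_blockA_single α O).symm⟩

theorem blockIdentity_mem_A (α : D.Sector) : D.blockIdentity α ∈ codeSubalgebraA P := by
  rw [blockIdentity_eq_blockA]
  exact D.blockA_mem α 1

theorem blockIdentity_mem_B (α : D.Sector) : D.blockIdentity α ∈ codeSubalgebraB P := by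
  refine D.mem_codeSubalgebraB_iff_blocks.2
    ⟨Pi.single (M := fun β => Matrix (D.B₁ β) (D.B₁ β) ℂ) α 1, ?_⟩
  rw [blockIdentity_eq_blockB, Finset.sum_eq_single α]
  · rw [Pi.single_eq_same]
  · intro β _ h
    rw [Pi.single_eq_of_ne h]
    simp [blockB]
  · simp

theorem blockIdentity_mulVec (α : D.Sector) (i : D.A₁ α) (j : D.B₁ α) :
    D.blockIdentity α *ᵥ D.word α i j = D.word α i j := by
  rw [blockIdentity_eq_blockA, blockA_mulVec, Finset.sum_eq_single i]
  · simp
  · intro k _ hk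
    simp [Matrix.one_apply_ne hk]
  · simp

theorem blockIdentity_mulVec_of_ne {α β : D.Sector} (h : α ≠ β) (i : D.A₁ β) (j : D.B₁ β) :
    D.blockIdentity α *ᵥ D.word β i j = 0 := by
  rw [blockIdentity_eq_blockA, blockA_mulVec_of_ne D h]

theorem blockIdentity_mul_blockA (α : D.Sector) (O : Matrix (D.A₁ α) (D.A₁ α) ℂ) :
    D.blockIdentity α * D.blockA α O = D.blockA α O := by
  simp only [blockA_apply, Finset.mul_sum, Matrix.mul_smul, mul_ketBra, blockIdentity_mulVec]

theorem blockIdentity_mul_blockA_of_ne {α β : D.Sector} (h : α ≠ β)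
    (O : Matrix (D.A₁ β) (D.A₁ β) ℂ) : D.blockIdentity α * D.blockA β O = 0 := by
  simp [blockA_apply, Finset.mul_sum, mul_ketBra, blockIdentity_mulVec_of_ne D h, zero_ketBra]

theorem blockIdentity_mul_self (α : D.Sector) :
    D.blockIdentity α * D.blockIdentity α = D.blockIdentity α := by
  have := D.blockIdentity_mul_blockA α 1
  rwa [← blockIdentity_eq_blockA] at this

theorem blockIdentity_mul_of_ne {α β : D.Sector} (h : α ≠ β) :
    D.blockIdentity α * D.blockIdentity β = 0 := by
  rw [blockIdentity_eq_blockA D β, blockIdentity_mul_blockA_of_ne D h]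

theorem trace_blockIdentity (α : D.Sector) :
    (D.blockIdentity α).trace = Fintype.card (D.A₁ α) * Fintype.card (D.B₁ α) := by
  simp [blockIdentity, Matrix.trace_sum, trace_ketBra, word_orthonormal]

theorem blockIdentity_ne_zero (α : D.Sector) : D.blockIdentity α ≠ 0 := by
  intro h
  have := D.trace_blockIdentity α
  rw [h, Matrix.trace_zero] at this
  have h2 : Fintype.card (D.A₁ α) * Fintype.card (D.B₁ α) = 0 := by exact_mod_cast this.symm
  exact absurd h2 (Nat.mul_ne_zero Fintype.card_ne_zero Fintype.card_ne_zero)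

theorem conjTranspose_blockIdentity (α : D.Sector) :
    (D.blockIdentity α)ᴴ = D.blockIdentity α := by
  simp only [blockIdentity, Matrix.conjTranspose_sum, conjTranspose_ketBra]

theorem blockIdentity_injective : Function.Injective D.blockIdentity := by
  intro α β h
  by_contra hne
  have h0 := D.blockIdentity_mul_of_ne hne
  rw [← h, blockIdentity_mul_self] at h0
  exact D.blockIdentity_ne_zero α h0

theorem blockA_injective (α : D.Sector) : Function.Injective (D.blockA α) := by
  rw [injective_iff_map_eq_zero]
  intro O hO
  obtain ⟨j⟩ := D.nonemptyB₁ α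
  ext i i'
  have h := congrArg (fun X => star (D.word α i j) ⬝ᵥ (X *ᵥ D.word α i' j)) hO
  simpa [blockA_mulVec, dotProduct_sum, dotProduct_smul, word_orthonormal] using h

/-- The members of `M_A` in the block `α` are the `O ⊗ 1`. -/
theorem exists_blockA_of_mem {X : Matrix (a × b) (a × b) ℂ} (hX : X ∈ codeSubalgebraA P)
    {α : D.Sector} (h : D.blockIdentity α * X = X) : ∃ O, X = D.blockA α O := by
  obtain ⟨O, hO⟩ := D.mem_codeSubalgebraA_iff_blocks.1 hX
  refine ⟨O α, ?_⟩
  rw [← h, hO, Finset.mul_sum, Finset.sum_eq_single α]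
  · exact D.blockIdentity_mul_blockA α _
  · intro β _ hβ
    exact D.blockIdentity_mul_blockA_of_ne hβ.symm _
  · simp

/-- The intersection of `M_A` and `M_Ā`, their common center, is spanned by the block
identities: an operator that is both `O ⊗ 1` and `1 ⊗ O'` on each block is a scalar there. -/
theorem exists_eq_sum_blockIdentity {X : Matrix (a × b) (a × b) ℂ}
    (hA : X ∈ codeSubalgebraA P) (hB : X ∈ codeSubalgebraB P) :
    ∃ z : D.Sector → ℂ, X = ∑ α, z α • D.blockIdentity α := by
  obtain ⟨O, hO⟩ := D.mem_codeSubalgebraA_iff_blocks.1 hA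
  obtain ⟨O', hO'⟩ := D.mem_codeSubalgebraB_iff_blocks.1 hB
  have e1 : ∀ α i i' j j', star (D.word α i j) ⬝ᵥ (X *ᵥ D.word α i' j')
      = if j = j' then O α i i' else 0 := by
    intro α i i' j j'
    have : X *ᵥ D.word α i' j' = ∑ i, O α i i' • D.word α i j' := by
      rw [hO, Matrix.sum_mulVec, Finset.sum_eq_single α, blockA_mulVec]
      · intro β _ hβ
        rw [blockA_mulVec_of_ne D hβ]
      · simp
    rw [this, dotProduct_sum]
    simp only [dotProduct_smul, word_orthonormal, smul_eq_mul]
    rw [Finset.sum_eq_single i]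
    · simp
    · intro k _ hk
      simp [hk.symm]
    · simp
  have e2 : ∀ α i i' j j', star (D.word α i j) ⬝ᵥ (X *ᵥ D.word α i' j')
      = if i = i' then O' α j j' else 0 := by
    intro α i i' j j'
    have : X *ᵥ D.word α i' j' = ∑ j, O' α j j' • D.word α i' j := by
      rw [hO', Matrix.sum_mulVec, Finset.sum_eq_single α, blockB_mulVec]
      · intro β _ hβ
        rw [blockB_mulVec_of_ne D hβ]
      · simp
    rw [this, dotProduct_sum]
    simp only [dotProduct_smul, word_orthonormal, smul_eq_mul]
    rw [Finset.sum_eq_single j]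
    · simp
    · intro k _ hk
      simp [hk.symm]
    · simp
  have e3 : ∀ α i i' j, O α i i' = if i = i' then O' α j j else 0 := fun α i i' j => by
    rw [← e2, e1, if_pos rfl]
  refine ⟨fun α => O' α (D.nonemptyB₁ α).some (D.nonemptyB₁ α).some, ?_⟩
  rw [hO]
  refine Finset.sum_congr rfl fun α _ => ?_
  rw [blockIdentity_eq_blockA, ← map_smul]
  congr 1
  ext i i'
  rw [e3 α i i' (D.nonemptyB₁ α).some, Matrix.smul_apply, Matrix.one_apply]
  simp

end ComplementaryRecovery
end Blocks

/-! ### Local unitary symmetries and the area operator -/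

section Symmetry

variable {a b : Type*} [Fintype a] [DecidableEq a] [Fintype b] [DecidableEq b]

/-- The partial trace over the second factor. -/
def traceB (X : Matrix (a × b) (a × b) ℂ) : Matrix a a ℂ :=
  Matrix.of fun x x' => ∑ y, X (x, y) (x', y)

theorem traceB_kronecker_conj {UB : Matrix b b ℂ} (hB : UBᴴ * UB = 1) (UA : Matrix a a ℂ)
    (X : Matrix (a × b) (a × b) ℂ) :
    traceB ((UA ⊗ₖ UB) * X * (UA ⊗ₖ UB)ᴴ) = UA * traceB X * UAᴴ := by
  have h : ∀ y y', ∑ z, UB z y * star (UB z y') = if y' = y then 1 else 0 := by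
    intro y y'
    have := congrFun (congrFun hB y') y
    rw [Matrix.mul_apply, Matrix.one_apply] at this
    rw [← this]
    exact Finset.sum_congr rfl fun z _ => mul_comm _ _
  ext x x'
  have e1 : traceB ((UA ⊗ₖ UB) * X * (UA ⊗ₖ UB)ᴴ) x x' = ∑ z, ∑ w', ∑ y', ∑ w, ∑ y,
      UA x w * X (w, y) (w', y') * star (UA x' w') * (UB z y * star (UB z y')) := by
    simp only [traceB, Matrix.of_apply, Matrix.mul_apply, Fintype.sum_prod_type,
      Matrix.conjTranspose_apply, Matrix.kronecker_apply, Finset.sum_mul, star_mul']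
    refine Finset.sum_congr rfl fun z _ => Finset.sum_congr rfl fun w' _ =>
      Finset.sum_congr rfl fun y' _ => Finset.sum_congr rfl fun w _ =>
      Finset.sum_congr rfl fun y _ => by ring
  have e2 : (UA * traceB X * UAᴴ) x x' = ∑ w', ∑ w, ∑ y,
      UA x w * X (w, y) (w', y) * star (UA x' w') := by
    simp only [traceB, Matrix.of_apply, Matrix.mul_apply, Matrix.conjTranspose_apply,
      Finset.sum_mul, Finset.mul_sum]
  rw [e1, e2, Finset.sum_comm]
  refine Finset.sum_congr rfl fun w' _ => ?_
  rw [Finset.sum_comm]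
  have e3 : ∀ y', ∑ z, ∑ w, ∑ y,
      UA x w * X (w, y) (w', y') * star (UA x' w') * (UB z y * star (UB z y'))
      = ∑ w, UA x w * X (w, y') (w', y') * star (UA x' w') := by
    intro y'
    rw [Finset.sum_comm]
    refine Finset.sum_congr rfl fun w _ => ?_
    rw [Finset.sum_comm]
    simp_rw [← Finset.mul_sum, h]
    simp
  simp_rw [e3]
  exact Finset.sum_comm

theorem conj_mem_codeSubalgebraA {P P' : Matrix (a × b) (a × b) ℂ} (hP : Pᴴ = P) (hP' : P'ᴴ = P')
    {UA : Matrix a a ℂ} {UB : Matrix b b ℂ} (hB : UB * UBᴴ = 1)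
    (hU : (UA ⊗ₖ UB) * P * (UA ⊗ₖ UB)ᴴ = P') (hUU : (UA ⊗ₖ UB)ᴴ * (UA ⊗ₖ UB) = 1)
    {X : Matrix (a × b) (a × b) ℂ} (hX : X ∈ codeSubalgebraA P) :
    (UA ⊗ₖ UB) * X * (UA ⊗ₖ UB)ᴴ ∈ codeSubalgebraA P' := by
  obtain ⟨O, h1, h2⟩ := (mem_codeSubalgebraA_iff hP).1 hX
  have hO : (UA * O * UAᴴ) ⊗ₖ (1 : Matrix b b ℂ)
      = (UA ⊗ₖ UB) * (O ⊗ₖ (1 : Matrix b b ℂ)) * (UA ⊗ₖ UB)ᴴ := by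
    rw [Matrix.conjTranspose_kronecker, ← Matrix.mul_kronecker_mul, ← Matrix.mul_kronecker_mul,
      mul_one, hB]
  refine (mem_codeSubalgebraA_iff hP').2 ⟨UA * O * UAᴴ, ?_, ?_⟩
  · rw [hO, ← h1]
    conv_lhs => rw [← hU]
    calc _ = (UA ⊗ₖ UB) * (O ⊗ₖ (1 : Matrix b b ℂ)) * ((UA ⊗ₖ UB)ᴴ * (UA ⊗ₖ UB)) * P
          * (UA ⊗ₖ UB)ᴴ := by simp only [mul_assoc]
      _ = _ := by rw [hUU]; simp only [mul_assoc, one_mul]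
  · rw [hO, ← h2]
    conv_lhs => rw [← hU]
    calc _ = (UA ⊗ₖ UB) * P * ((UA ⊗ₖ UB)ᴴ * (UA ⊗ₖ UB)) * (O ⊗ₖ (1 : Matrix b b ℂ))
          * (UA ⊗ₖ UB)ᴴ := by simp only [mul_assoc]
      _ = _ := by rw [hUU]; simp only [mul_assoc, one_mul]

theorem conj_mem_codeSubalgebraB {P P' : Matrix (a × b) (a × b) ℂ} (hP : Pᴴ = P) (hP' : P'ᴴ = P')
    {UA : Matrix a a ℂ} {UB : Matrix b b ℂ} (hA : UA * UAᴴ = 1)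
    (hU : (UA ⊗ₖ UB) * P * (UA ⊗ₖ UB)ᴴ = P') (hUU : (UA ⊗ₖ UB)ᴴ * (UA ⊗ₖ UB) = 1)
    {X : Matrix (a × b) (a × b) ℂ} (hX : X ∈ codeSubalgebraB P) :
    (UA ⊗ₖ UB) * X * (UA ⊗ₖ UB)ᴴ ∈ codeSubalgebraB P' := by
  obtain ⟨O, h1, h2⟩ := (mem_codeSubalgebraB_iff hP).1 hX
  have hO : (1 : Matrix a a ℂ) ⊗ₖ (UB * O * UBᴴ)
      = (UA ⊗ₖ UB) * ((1 : Matrix a a ℂ) ⊗ₖ O) * (UA ⊗ₖ UB)ᴴ := by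
    rw [Matrix.conjTranspose_kronecker, ← Matrix.mul_kronecker_mul, ← Matrix.mul_kronecker_mul,
      mul_one, hA]
  refine (mem_codeSubalgebraB_iff hP').2 ⟨UB * O * UBᴴ, ?_, ?_⟩
  · rw [hO, ← h1]
    conv_lhs => rw [← hU]
    calc _ = (UA ⊗ₖ UB) * ((1 : Matrix a a ℂ) ⊗ₖ O) * ((UA ⊗ₖ UB)ᴴ * (UA ⊗ₖ UB)) * P
          * (UA ⊗ₖ UB)ᴴ := by simp only [mul_assoc]
      _ = _ := by rw [hUU]; simp only [mul_assoc, one_mul]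
  · rw [hO, ← h2]
    conv_lhs => rw [← hU]
    calc _ = (UA ⊗ₖ UB) * P * ((UA ⊗ₖ UB)ᴴ * (UA ⊗ₖ UB)) * ((1 : Matrix a a ℂ) ⊗ₖ O)
          * (UA ⊗ₖ UB)ᴴ := by simp only [mul_assoc]
      _ = _ := by rw [hUU]; simp only [mul_assoc, one_mul]

/-- A pair of unitaries on `H_A` and `H_Ā` whose product preserves the code with projector `P`. -/
structure IsLocalSymmetry (P : Matrix (a × b) (a × b) ℂ) (UA : Matrix a a ℂ)
    (UB : Matrix b b ℂ) : Prop where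
  unitaryA : UAᴴ * UA = 1
  unitaryB : UBᴴ * UB = 1
  commute : (UA ⊗ₖ UB) * P = P * (UA ⊗ₖ UB)

namespace IsLocalSymmetry

variable {P : Matrix (a × b) (a × b) ℂ} {UA : Matrix a a ℂ} {UB : Matrix b b ℂ}

theorem conj_mul (h : IsLocalSymmetry P UA UB) : (UA ⊗ₖ UB)ᴴ * (UA ⊗ₖ UB) = 1 := by
  rw [Matrix.conjTranspose_kronecker, ← Matrix.mul_kronecker_mul, h.unitaryA, h.unitaryB,
    Matrix.one_kronecker_one]

theorem mul_conj (h : IsLocalSymmetry P UA UB) : (UA ⊗ₖ UB) * (UA ⊗ₖ UB)ᴴ = 1 :=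
  mul_eq_one_comm.1 h.conj_mul

theorem conj_eq (h : IsLocalSymmetry P UA UB) : (UA ⊗ₖ UB) * P * (UA ⊗ₖ UB)ᴴ = P := by
  rw [h.commute, mul_assoc, h.mul_conj, mul_one]

theorem symm (h : IsLocalSymmetry P UA UB) : IsLocalSymmetry P UAᴴ UBᴴ where
  unitaryA := by rw [Matrix.conjTranspose_conjTranspose]; exact mul_eq_one_comm.1 h.unitaryA
  unitaryB := by rw [Matrix.conjTranspose_conjTranspose]; exact mul_eq_one_comm.1 h.unitaryB
  commute := by
    rw [← Matrix.conjTranspose_kronecker]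
    calc (UA ⊗ₖ UB)ᴴ * P = (UA ⊗ₖ UB)ᴴ * ((UA ⊗ₖ UB) * P * (UA ⊗ₖ UB)ᴴ) := by rw [h.conj_eq]
      _ = ((UA ⊗ₖ UB)ᴴ * (UA ⊗ₖ UB)) * (P * (UA ⊗ₖ UB)ᴴ) := by simp only [mul_assoc]
      _ = _ := by rw [h.conj_mul, one_mul]

end IsLocalSymmetry

namespace ComplementaryRecovery

variable {P : Matrix (a × b) (a × b) ℂ} (D : ComplementaryRecovery P)

/-- The state of the block `α` reduced to `A` is, up to normalization, `1 ⊗ ρ_α` with `ρ_α` the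
reduced state of `|χ_α⟩`. -/
theorem traceB_blockIdentity (α : D.Sector) : traceB (D.blockIdentity α)
    = ∑ i, D.colA α i * ((Fintype.card (D.B₁ α) : ℂ) • reducedState (D.χ α)) * (D.colA α i)ᴴ := by
  have h1 : traceB (D.blockIdentity α)
      = ∑ i, ∑ j, D.wordMat α i j * (D.wordMat α i j)ᴴ := by
    ext x x'
    simp only [traceB, blockIdentity, Matrix.of_apply, Matrix.sum_apply, Matrix.mul_apply,
      Matrix.conjTranspose_apply, ← word_apply, ketBra, Matrix.vecMulVec_apply, Pi.star_apply]
    rw [Finset.sum_comm]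
    exact Finset.sum_congr rfl fun i _ => Finset.sum_comm
  have h2 : D.chiMat α * (D.chiMat α)ᴴ = reducedState (D.χ α) := by
    ext k k'
    rfl
  have h3 : ∀ j, (D.colB α j)ᵀ * ((D.colB α j)ᵀ)ᴴ = 1 := fun j => by
    rw [transpose_colB_mul, colB_same, Matrix.transpose_one]
  rw [h1]
  refine Finset.sum_congr rfl fun i _ => ?_
  have h4 : ∀ j, D.wordMat α i j * (D.wordMat α i j)ᴴ
      = D.colA α i * reducedState (D.χ α) * (D.colA α i)ᴴ := by
    intro j
    rw [wordMat, Matrix.conjTranspose_mul, Matrix.conjTranspose_mul, ← h2]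
    calc _ = D.colA α i * D.chiMat α * ((D.colB α j)ᵀ * ((D.colB α j)ᵀ)ᴴ) * (D.chiMat α)ᴴ
          * (D.colA α i)ᴴ := by simp only [Matrix.mul_assoc]
      _ = _ := by rw [h3]; simp only [Matrix.mul_assoc, Matrix.one_mul]
  simp_rw [h4]
  rw [Finset.sum_const, Finset.card_univ, Matrix.mul_smul, Matrix.smul_mul, Nat.cast_smul_eq_nsmul]

theorem pow_sum_colA (α : D.Sector) (K : Matrix (D.A₂ α) (D.A₂ α) ℂ) (k : ℕ) :
    (∑ i, D.colA α i * K * (D.colA α i)ᴴ) ^ (k + 1)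
      = ∑ i, D.colA α i * K ^ (k + 1) * (D.colA α i)ᴴ := by
  induction k with
  | zero => simp
  | succ k ih =>
    rw [pow_succ, ih, Finset.sum_mul]
    refine Finset.sum_congr rfl fun i _ => ?_
    rw [Finset.mul_sum, Finset.sum_eq_single i]
    · calc _ = D.colA α i * K ^ (k + 1) * ((D.colA α i)ᴴ * D.colA α i) * K * (D.colA α i)ᴴ := by
            simp only [Matrix.mul_assoc]
        _ = _ := by
            rw [colA_same, Matrix.mul_one, pow_succ K (k + 1)]
            simp only [Matrix.mul_assoc]
    · intro j _ hj
      calc _ = D.colA α i * K ^ (k + 1) * ((D.colA α i)ᴴ * D.colA α j) * K * (D.colA α j)ᴴ := by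
            simp only [Matrix.mul_assoc]
        _ = 0 := by rw [colA_of_ne D α hj.symm]; simp
    · simp

theorem trace_pow_traceB (α : D.Sector) (k : ℕ) : (traceB (D.blockIdentity α) ^ (k + 1)).trace
    = Fintype.card (D.A₁ α) * ((Fintype.card (D.B₁ α) : ℂ) ^ (k + 1)
      * (reducedState (D.χ α) ^ (k + 1)).trace) := by
  rw [traceB_blockIdentity, pow_sum_colA, Matrix.trace_sum]
  have : ∀ i, (D.colA α i * ((Fintype.card (D.B₁ α) : ℂ) • reducedState (D.χ α)) ^ (k + 1)
      * (D.colA α i)ᴴ).trace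
      = (Fintype.card (D.B₁ α) : ℂ) ^ (k + 1) * (reducedState (D.χ α) ^ (k + 1)).trace := by
    intro i
    rw [Matrix.trace_mul_comm, ← Matrix.mul_assoc, colA_same, Matrix.one_mul, smul_pow,
      Matrix.trace_smul, smul_eq_mul]
  simp_rw [this]
  rw [Finset.sum_const, Finset.card_univ, nsmul_eq_mul]

variable {D} {UA : Matrix a a ℂ} {UB : Matrix b b ℂ}

/-- A local symmetry carrying the block `α` into the block `β` embeds the operators `O ⊗ 1` of the
first into those of the second. -/
theorem card_A₁_le_of_conj (hP : Pᴴ = P) (hU : IsLocalSymmetry P UA UB) {α β : D.Sector}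
    (h : (UA ⊗ₖ UB) * D.blockIdentity α * (UA ⊗ₖ UB)ᴴ = D.blockIdentity β) :
    Fintype.card (D.A₁ α) ≤ Fintype.card (D.A₁ β) := by
  let φ : Matrix (D.A₁ α) (D.A₁ α) ℂ →ₗ[ℂ] Matrix (a × b) (a × b) ℂ :=
    (LinearMap.mulRight ℂ (UA ⊗ₖ UB)ᴴ) ∘ₗ (LinearMap.mulLeft ℂ (UA ⊗ₖ UB)) ∘ₗ D.blockA α
  have hφ : ∀ O, φ O = (UA ⊗ₖ UB) * D.blockA α O * (UA ⊗ₖ UB)ᴴ := fun O => rfl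
  have hinj : Function.Injective φ := by
    intro O O' hOO
    apply D.blockA_injective α
    have := congrArg (fun X => (UA ⊗ₖ UB)ᴴ * X * (UA ⊗ₖ UB)) hOO
    simp only [hφ] at this
    have e : ∀ X, (UA ⊗ₖ UB)ᴴ * ((UA ⊗ₖ UB) * X * (UA ⊗ₖ UB)ᴴ) * (UA ⊗ₖ UB) = X := by
      intro X
      calc _ = ((UA ⊗ₖ UB)ᴴ * (UA ⊗ₖ UB)) * X * ((UA ⊗ₖ UB)ᴴ * (UA ⊗ₖ UB)) := by
            simp only [mul_assoc]
        _ = X := by rw [hU.conj_mul, one_mul, mul_one]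
    rwa [e, e] at this
  have hle : LinearMap.range φ ≤ LinearMap.range (D.blockA β) := by
    rintro _ ⟨O, rfl⟩
    rw [hφ]
    obtain ⟨O', hO'⟩ := D.exists_blockA_of_mem (α := β)
      (conj_mem_codeSubalgebraA hP hP (mul_eq_one_comm.1 hU.unitaryB) hU.conj_eq hU.conj_mul
        (D.blockA_mem α O)) (by
        rw [← h]
        calc _ = (UA ⊗ₖ UB) * D.blockIdentity α * ((UA ⊗ₖ UB)ᴴ * (UA ⊗ₖ UB)) * D.blockA α O
              * (UA ⊗ₖ UB)ᴴ := by simp only [mul_assoc]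
          _ = (UA ⊗ₖ UB) * (D.blockIdentity α * D.blockA α O) * (UA ⊗ₖ UB)ᴴ := by
              rw [hU.conj_mul]; simp only [mul_assoc, one_mul]
          _ = _ := by rw [D.blockIdentity_mul_blockA])
    exact ⟨O', hO'.symm⟩
  have := Submodule.finrank_mono hle
  rw [LinearMap.finrank_range_of_inj hinj, LinearMap.finrank_range_of_inj (D.blockA_injective β),
    Module.finrank_matrix, Module.finrank_matrix, Module.finrank_self, mul_one, mul_one] at this
  exact Nat.mul_self_le_mul_self_iff.1 this

theorem blockIdentity_conj_symm (hU : IsLocalSymmetry P UA UB) {α β : D.Sector}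
    (h : (UA ⊗ₖ UB) * D.blockIdentity α * (UA ⊗ₖ UB)ᴴ = D.blockIdentity β) :
    (UAᴴ ⊗ₖ UBᴴ) * D.blockIdentity β * (UAᴴ ⊗ₖ UBᴴ)ᴴ = D.blockIdentity α := by
  rw [← h, ← Matrix.conjTranspose_kronecker, Matrix.conjTranspose_conjTranspose]
  calc _ = ((UA ⊗ₖ UB)ᴴ * (UA ⊗ₖ UB)) * D.blockIdentity α * ((UA ⊗ₖ UB)ᴴ * (UA ⊗ₖ UB)) := by
        simp only [mul_assoc]
    _ = _ := by rw [hU.conj_mul, one_mul, mul_one]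

/-- Blocks related by a local symmetry have the same entropy: their reduced states on `A` are
unitarily equivalent and the dimensions of their tensor factors agree. -/
theorem sectorEntropy_eq_of_conj (hP : Pᴴ = P) (hU : IsLocalSymmetry P UA UB) {α β : D.Sector}
    (h : (UA ⊗ₖ UB) * D.blockIdentity α * (UA ⊗ₖ UB)ᴴ = D.blockIdentity β) :
    D.sectorEntropy α = D.sectorEntropy β := by
  have hA : Fintype.card (D.A₁ α) = Fintype.card (D.A₁ β) :=
    le_antisymm (card_A₁_le_of_conj hP hU h)
      (card_A₁_le_of_conj hP hU.symm (blockIdentity_conj_symm hU h))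
  have hA0 : (Fintype.card (D.A₁ β) : ℂ) ≠ 0 := by exact_mod_cast Fintype.card_ne_zero
  have hB0 : (Fintype.card (D.B₁ β) : ℂ) ≠ 0 := by exact_mod_cast Fintype.card_ne_zero
  have hB : (Fintype.card (D.B₁ α) : ℂ) = Fintype.card (D.B₁ β) := by
    have := D.trace_blockIdentity β
    rw [← h, Matrix.trace_mul_comm, ← mul_assoc, hU.conj_mul, one_mul, D.trace_blockIdentity,
      hA] at this
    exact mul_left_cancel₀ hA0 this
  refine vonNeumannEntropy_eq_of_trace_pow_eq _ _ fun k => ?_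
  have h1 := D.trace_pow_traceB β k
  rw [← h, traceB_kronecker_conj hU.unitaryB,
    conj_pow hU.unitaryA (mul_eq_one_comm.1 hU.unitaryA), Matrix.trace_mul_comm, ← mul_assoc,
    hU.unitaryA, one_mul, D.trace_pow_traceB, hA, hB] at h1
  exact mul_left_cancel₀ (pow_ne_zero _ hB0) (mul_left_cancel₀ hA0 h1)

variable (D) in
theorem exists_blockIdentity_mul_eq_smul {X : Matrix (a × b) (a × b) ℂ}
    (hA : X ∈ codeSubalgebraA P) (hB : X ∈ codeSubalgebraB P) (β : D.Sector) :
    ∃ z : ℂ, D.blockIdentity β * X = z • D.blockIdentity β := by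
  obtain ⟨z, rfl⟩ := D.exists_eq_sum_blockIdentity hA hB
  refine ⟨z β, ?_⟩
  rw [Finset.mul_sum, Finset.sum_eq_single β]
  · rw [Matrix.mul_smul, D.blockIdentity_mul_self]
  · intro γ _ hγ
    rw [Matrix.mul_smul, D.blockIdentity_mul_of_ne hγ.symm, smul_zero]
  · simp

/-- A local symmetry permutes the blocks, since the block identities are the minimal projections
of the center `M_A ∩ M_Ā`, which it preserves. -/
theorem exists_blockIdentity_conj (hP : Pᴴ = P) (hPi : P * P = P) (hU : IsLocalSymmetry P UA UB)
    (α : D.Sector) :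
    ∃ β, (UA ⊗ₖ UB) * D.blockIdentity α * (UA ⊗ₖ UB)ᴴ = D.blockIdentity β := by
  set U := UA ⊗ₖ UB with hUdef
  have h1 : Uᴴ * U = 1 := hU.conj_mul
  have h2 : U * Uᴴ = 1 := hU.mul_conj
  set F := U * D.blockIdentity α * Uᴴ with hF
  have hFA : F ∈ codeSubalgebraA P := conj_mem_codeSubalgebraA hP hP
    (mul_eq_one_comm.1 hU.unitaryB) hU.conj_eq h1 (D.blockIdentity_mem_A α)
  have hFB : F ∈ codeSubalgebraB P := conj_mem_codeSubalgebraB hP hP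
    (mul_eq_one_comm.1 hU.unitaryA) hU.conj_eq h1 (D.blockIdentity_mem_B α)
  have hFb : Uᴴ * F * U = D.blockIdentity α := by
    calc _ = (Uᴴ * U) * D.blockIdentity α * (Uᴴ * U) := by rw [hF]; simp only [mul_assoc]
      _ = _ := by rw [h1, one_mul, mul_one]
  have hFi : F * F = F := by
    calc _ = U * D.blockIdentity α * (Uᴴ * U) * D.blockIdentity α * Uᴴ := by
          rw [hF]; simp only [mul_assoc]
      _ = U * (D.blockIdentity α * D.blockIdentity α) * Uᴴ := by
          rw [h1, mul_one]; simp only [mul_assoc]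
      _ = F := by rw [D.blockIdentity_mul_self]
  -- Some block `β` meets `F`, and hence lies under it.
  obtain ⟨β, hβ⟩ : ∃ β, D.blockIdentity β * F ≠ 0 := by
    by_contra! hcon
    apply D.blockIdentity_ne_zero α
    rw [← hFb, ← (mul_eq_of_mem_codeSubalgebraA hP hPi hFA).1, ← D.sum_blockIdentity,
      Finset.sum_mul, Finset.sum_eq_zero fun γ _ => hcon γ, mul_zero, zero_mul]
  obtain ⟨z, hz⟩ := D.exists_blockIdentity_mul_eq_smul hFA hFB β
  have hz0 : z ≠ 0 := by
    rintro rfl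
    exact hβ (by rw [hz, zero_smul])
  have hz1 : D.blockIdentity β * F = D.blockIdentity β := by
    have : (z * z) • D.blockIdentity β = z • D.blockIdentity β := by
      rw [mul_smul, ← hz, ← Matrix.smul_mul, ← hz, mul_assoc, hFi]
    have := smul_left_injective ℂ (D.blockIdentity_ne_zero β) this
    rw [hz, mul_right_cancel₀ hz0 (this.trans (one_mul z).symm), one_smul]
  -- Conjugating back, the block `β` is carried under the block `α`, to a multiple of it.
  have hs := hU.symm
  set K := UAᴴ ⊗ₖ UBᴴ with hK
  have hKU : K = Uᴴ := by rw [hK, hUdef, Matrix.conjTranspose_kronecker]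
  have hKh : Kᴴ = U := by rw [hKU, Matrix.conjTranspose_conjTranspose]
  obtain ⟨d, hd⟩ := D.exists_blockIdentity_mul_eq_smul
    (conj_mem_codeSubalgebraA hP hP (mul_eq_one_comm.1 hs.unitaryB) hs.conj_eq hs.conj_mul
      (D.blockIdentity_mem_A β))
    (conj_mem_codeSubalgebraB hP hP (mul_eq_one_comm.1 hs.unitaryA) hs.conj_eq hs.conj_mul
      (D.blockIdentity_mem_B β)) α
  rw [← hK, hKh, hKU] at hd
  have hz2 : F * D.blockIdentity β = D.blockIdentity β := by
    rw [commute_codeSubalgebras hP hPi hFA (D.blockIdentity_mem_B β), hz1]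
  have hd2 : D.blockIdentity β = d • F := by
    calc D.blockIdentity β = F * D.blockIdentity β := hz2.symm
      _ = U * D.blockIdentity α * Uᴴ * D.blockIdentity β * (U * Uᴴ) := by rw [h2, mul_one]
      _ = U * (D.blockIdentity α * (Uᴴ * D.blockIdentity β * U)) * Uᴴ := by
          simp only [mul_assoc]
      _ = d • F := by rw [hd, Matrix.mul_smul, Matrix.smul_mul]
  -- A projection that is `d` times a projection has `d = 1`.
  have hd3 : d • D.blockIdentity β = D.blockIdentity β := by
    calc d • D.blockIdentity β = d • (F * D.blockIdentity β) := by rw [hz2]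
      _ = D.blockIdentity β * D.blockIdentity β := by rw [← Matrix.smul_mul, ← hd2]
      _ = _ := D.blockIdentity_mul_self β
  have hd4 : d = 1 := smul_left_injective ℂ (D.blockIdentity_ne_zero β)
    (hd3.trans (one_smul ℂ _).symm)
  exact ⟨β, by rw [hd2, hd4, one_smul]⟩

theorem areaOperator_commute (hP : Pᴴ = P) (hPi : P * P = P) (hU : IsLocalSymmetry P UA UB) :
    (UA ⊗ₖ UB) * D.areaOperator = D.areaOperator * (UA ⊗ₖ UB) := by
  choose π hπ using exists_blockIdentity_conj (D := D) hP hPi hU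
  have hinj : Function.Injective π := by
    intro α β h
    apply D.blockIdentity_injective
    rw [← blockIdentity_conj_symm hU (hπ α), ← blockIdentity_conj_symm hU (hπ β), h]
  have hconj : (UA ⊗ₖ UB) * D.areaOperator * (UA ⊗ₖ UB)ᴴ = D.areaOperator := by
    rw [areaOperator, Finset.mul_sum, Finset.sum_mul]
    conv_rhs => rw [← (Equiv.ofBijective π (Finite.injective_iff_bijective.1 hinj)).sum_comp]
    refine Finset.sum_congr rfl fun α _ => ?_
    rw [Matrix.mul_smul, Matrix.smul_mul, hπ, sectorEntropy_eq_of_conj hP hU (hπ α)]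
    rfl
  calc _ = (UA ⊗ₖ UB) * D.areaOperator * ((UA ⊗ₖ UB)ᴴ * (UA ⊗ₖ UB)) := by
        rw [hU.conj_mul, mul_one]
    _ = _ := by rw [← mul_assoc, hconj]

end ComplementaryRecovery

/-- A code on which every operator commuting with `M_A` lies in `M_Ā`, and whose local symmetries
have only scalars as common commutant, has a trivial area operator. -/
theorem hasTrivialAreaOperator_of_symmetry {P : Matrix (a × b) (a × b) ℂ} (hP : Pᴴ = P)
    (hPi : P * P = P)
    (hcomm : ∀ Y, P * Y = Y → Y * P = Y → (∀ X ∈ codeSubalgebraA P, X * Y = Y * X) →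
      Y ∈ codeSubalgebraB P)
    (hsymm : ∀ Y, P * Y = Y → Y * P = Y → (∀ UA UB, IsLocalSymmetry P UA UB →
      (UA ⊗ₖ UB) * Y = Y * (UA ⊗ₖ UB)) → ∃ z : ℂ, Y = z • P) :
    HasTrivialAreaOperator P := by
  obtain ⟨D₀⟩ := nonempty_complementaryRecovery hP hPi hcomm
  refine ⟨⟨_, D₀, rfl⟩, ?_⟩
  rintro _ ⟨D, rfl⟩
  have hl : P * D.areaOperator = D.areaOperator := by
    rw [ComplementaryRecovery.areaOperator, Finset.mul_sum]
    refine Finset.sum_congr rfl fun α _ => ?_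
    rw [Matrix.mul_smul, (mul_eq_of_mem_codeSubalgebraA hP hPi (D.blockIdentity_mem_A α)).1]
  have hh : D.areaOperatorᴴ = D.areaOperator := by
    simp only [ComplementaryRecovery.areaOperator, Matrix.conjTranspose_sum,
      Matrix.conjTranspose_smul, D.conjTranspose_blockIdentity, Complex.star_def,
      Complex.conj_ofReal]
  have hr : D.areaOperator * P = D.areaOperator := by
    rw [← Matrix.conjTranspose_inj, Matrix.conjTranspose_mul, hP, hh, hl]
  obtain ⟨z, hz⟩ := hsymm _ hl hr fun UA UB hU => D.areaOperator_commute hP hPi hU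
  -- The scalar may be taken real, since the area operator is Hermitian.
  have hz' : D.areaOperator = star z • P := by
    rw [← hh, hz, Matrix.conjTranspose_smul, hP]
  refine ⟨z.re, ?_⟩
  have h2 : D.areaOperator = (1 / 2 : ℂ) • (D.areaOperator + D.areaOperator) := by module
  rw [h2]
  conv_lhs =>
    arg 2; arg 1; rw [hz]
  rw [hz', ← add_smul, Complex.star_def, Complex.add_conj, smul_smul]
  congr 1
  push_cast
  ring

end Symmetry

/-! ### Weyl operators on a finite abelian group -/

section Weyl

variable {H : Type*} [AddCommGroup H] [Fintype H] [DecidableEq H]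

/-- The Weyl operator `|y⟩ ↦ χ(y) |y + a⟩` of a point `v = (a, χ)` of the phase space
`H × AddChar H ℂ`. With `H` the product of the groups of all qudits, the Weyl operators are, up to
phases, the Pauli operators. -/
def weyl (v : H × AddChar H ℂ) : Matrix H H ℂ := pauliSite v.1 v.2

theorem weyl_apply (v : H × AddChar H ℂ) (x y : H) :
    weyl v x y = if x = y + v.1 then v.2 y else 0 := rfl

/-- Symplectic orthogonality of two points of the phase space: their Weyl operators commute. -/
def Orth (v w : H × AddChar H ℂ) : Prop := v.2 w.1 = w.2 v.1

theorem Orth.symm {v w : H × AddChar H ℂ} (h : Orth v w) : Orth w v := Eq.symm h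

theorem Orth.add {v w w' : H × AddChar H ℂ} (h : Orth v w) (h' : Orth v w') :
    Orth v (w + w') := by
  unfold Orth at *
  rw [Prod.fst_add, Prod.snd_add, AddChar.map_add_eq_mul, h, h', AddChar.add_apply]

theorem Orth.sub {v w w' : H × AddChar H ℂ} (h : Orth v w) (h' : Orth v w') :
    Orth v (w - w') := by
  rw [sub_eq_add_neg]
  refine h.add ?_
  unfold Orth at *
  rw [Prod.fst_neg, Prod.snd_neg, AddChar.map_neg_eq_inv, h', AddChar.neg_apply']

theorem orth_zero (v : H × AddChar H ℂ) : Orth v 0 := by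
  unfold Orth
  simp

theorem weyl_mul (v w : H × AddChar H ℂ) :
    weyl v * weyl w = v.2 w.1 • weyl (v + w) := by
  ext x y
  simp only [Matrix.mul_apply, weyl_apply, Matrix.smul_apply, smul_eq_mul, ite_mul, mul_ite,
    zero_mul, mul_zero]
  rw [Finset.sum_eq_single (y + w.1)]
  · rw [if_pos rfl, Prod.fst_add, Prod.snd_add, AddChar.add_apply, AddChar.map_add_eq_mul,
      show y + w.1 + v.1 = y + (v.1 + w.1) by abel]
    split_ifs
    · ring
    · rfl
  · intro z _ hz
    rw [if_neg hz]
  · simp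

theorem weyl_zero : weyl (0 : H × AddChar H ℂ) = 1 := by
  ext x y
  simp [weyl_apply, Matrix.one_apply]

theorem conjTranspose_weyl (v : H × AddChar H ℂ) : (weyl v)ᴴ = v.2 v.1 • weyl (-v) := by
  ext x y
  simp only [Matrix.conjTranspose_apply, weyl_apply, Matrix.smul_apply, smul_eq_mul,
    Prod.fst_neg, Prod.snd_neg, AddChar.neg_apply]
  by_cases h : y = x + v.1
  · have h' : x = y + -v.1 := by rw [h]; abel
    rw [if_pos h, if_pos h', ← AddChar.map_add_eq_mul, Complex.star_def,
      ← AddChar.map_neg_eq_conj, h]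
    congr 1
    abel
  · have h' : ¬ x = y + -v.1 := fun h' => h (by rw [h']; abel)
    rw [if_neg h, if_neg h', star_zero, mul_zero]

theorem addChar_ne_zero (χ : AddChar H ℂ) (x : H) : χ x ≠ 0 := by
  intro h
  have := χ.map_add_eq_mul x (-x)
  rw [h, zero_mul, add_neg_cancel, AddChar.map_zero_eq_one] at this
  exact one_ne_zero this

theorem conjTranspose_weyl_mul_self (v : H × AddChar H ℂ) : (weyl v)ᴴ * weyl v = 1 := by
  rw [conjTranspose_weyl, Matrix.smul_mul, weyl_mul, smul_smul, neg_add_cancel, weyl_zero,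
    Prod.snd_neg, AddChar.neg_apply, ← AddChar.map_add_eq_mul, add_neg_cancel,
    AddChar.map_zero_eq_one, one_smul]

theorem weyl_mul_conjTranspose_self (v : H × AddChar H ℂ) : weyl v * (weyl v)ᴴ = 1 :=
  mul_eq_one_comm.1 (conjTranspose_weyl_mul_self v)

theorem weyl_ne_zero (v : H × AddChar H ℂ) : weyl v ≠ 0 := by
  intro h
  have := conjTranspose_weyl_mul_self v
  rw [h, mul_zero] at this
  exact zero_ne_one this

theorem Orth.weyl_commute {v w : H × AddChar H ℂ} (h : Orth v w) :
    weyl v * weyl w = weyl w * weyl v := by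
  rw [weyl_mul, weyl_mul, h, add_comm]

/-- The Weyl operators span all operators: expansion in the orthogonal basis they form for the
trace inner product. -/
theorem eq_sum_weyl (X : Matrix H H ℂ) :
    X = ∑ v : H × AddChar H ℂ, ((Fintype.card H : ℂ)⁻¹ * ((weyl v)ᴴ * X).trace) • weyl v := by
  have htr : ∀ (a : H) (χ : AddChar H ℂ), ((weyl (a, χ))ᴴ * X).trace
      = ∑ z, χ (-z) * X (z + a) z := by
    intro a χ
    simp only [Matrix.trace, Matrix.diag_apply, Matrix.mul_apply, Matrix.conjTranspose_apply,
      weyl_apply]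
    refine Finset.sum_congr rfl fun z _ => ?_
    rw [Finset.sum_eq_single (z + a)]
    · rw [if_pos rfl, Complex.star_def, AddChar.map_neg_eq_conj]
    · intro w _ hw
      rw [if_neg hw, star_zero, zero_mul]
    · simp
  ext x y
  rw [Matrix.sum_apply, Fintype.sum_prod_type]
  simp only [Matrix.smul_apply, smul_eq_mul, weyl_apply, htr, mul_ite, mul_zero]
  rw [Finset.sum_eq_single (x - y)]
  · simp only [add_sub_cancel, if_true]
    have e1 : ∀ χ : AddChar H ℂ, (Fintype.card H : ℂ)⁻¹ * (∑ z, χ (-z) * X (z + (x - y)) z) * χ y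
        = ∑ z, (Fintype.card H : ℂ)⁻¹ * X (z + (x - y)) z * χ (y - z) := by
      intro χ
      rw [Finset.mul_sum, Finset.sum_mul]
      refine Finset.sum_congr rfl fun z _ => ?_
      rw [sub_eq_add_neg y z, AddChar.map_add_eq_mul]
      ring
    simp_rw [e1]
    rw [Finset.sum_comm]
    simp_rw [← Finset.mul_sum, AddChar.sum_apply_eq_ite]
    rw [Finset.sum_eq_single y]
    · have hc : (Fintype.card H : ℂ) ≠ 0 := by exact_mod_cast Fintype.card_ne_zero
      rw [sub_self, if_pos rfl, add_sub_cancel]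
      field_simp
    · intro z _ hz
      rw [if_neg (sub_ne_zero.2 hz.symm), mul_zero]
    · simp
  · intro w _ hw
    refine Finset.sum_eq_zero fun χ _ => if_neg fun h => hw ?_
    rw [h]
    abel
  · simp

/-- The Weyl operators occurring in an operator that commutes with `weyl t` commute with it. -/
theorem orth_of_trace_ne_zero {X : Matrix H H ℂ} {t v : H × AddChar H ℂ}
    (hX : weyl t * X = X * weyl t) (h0 : ((weyl v)ᴴ * X).trace ≠ 0) : Orth t v := by
  have h1 : weyl v * weyl t = (v.2 t.1 * (t.2 v.1)⁻¹) • (weyl t * weyl v) := by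
    rw [weyl_mul, weyl_mul, smul_smul, inv_mul_cancel_right₀ (addChar_ne_zero _ _), add_comm]
  set κ := v.2 t.1 * (t.2 v.1)⁻¹ with hκ
  have h2 : ((weyl v)ᴴ * X).trace = star κ * ((weyl v)ᴴ * X).trace := by
    calc ((weyl v)ᴴ * X).trace = ((weyl v)ᴴ * (X * weyl t) * (weyl t)ᴴ).trace := by
          simp only [mul_assoc]
          rw [weyl_mul_conjTranspose_self, mul_one]
      _ = (((weyl v) * (weyl t))ᴴ * weyl t * X).trace := by
          rw [← hX, Matrix.trace_mul_comm, Matrix.conjTranspose_mul]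
          simp only [mul_assoc]
      _ = (star κ • ((weyl v)ᴴ * ((weyl t)ᴴ * weyl t) * X)).trace := by
          rw [h1, Matrix.conjTranspose_smul, Matrix.conjTranspose_mul, Matrix.smul_mul,
            Matrix.smul_mul]
          simp only [mul_assoc]
      _ = _ := by
          rw [conjTranspose_weyl_mul_self, mul_one, Matrix.trace_smul, smul_eq_mul]
  have h3 : star κ = 1 := mul_right_cancel₀ h0 (by rw [← h2, one_mul])
  have h4 : κ = 1 := by rw [← star_star κ, h3, star_one]
  have h5 := mul_inv_eq_one₀ (addChar_ne_zero t.2 v.1) |>.1 (hκ.symm.trans h4)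
  exact h5.symm

/-- Double annihilators in the phase space: a point orthogonal to all points orthogonal to a
subgroup lies in the subgroup. Every character of the phase space is `v ↦ ⟨w, v⟩` for some point `w`
by Pontryagin duality, and the characters trivial on the subgroup separate its complement. -/
theorem mem_of_orth_orth (T : AddSubgroup (H × AddChar H ℂ)) (v : H × AddChar H ℂ)
    (h : ∀ w, (∀ t ∈ T, Orth t w) → Orth w v) : v ∈ T := by
  by_contra hv
  have hne : (QuotientAddGroup.mk' T v) ≠ 0 := fun h0 => hv ((QuotientAddGroup.eq_zero_iff v).1 h0)
  obtain ⟨ψ, hψ⟩ := AddChar.exists_apply_ne_zero.2 hne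
  let φ : AddChar (H × AddChar H ℂ) ℂ := ψ.compAddMonoidHom (QuotientAddGroup.mk' T)
  have hφT : ∀ t ∈ T, φ t = 1 := by
    intro t ht
    have : QuotientAddGroup.mk' T t = 0 := (QuotientAddGroup.eq_zero_iff t).2 ht
    rw [AddChar.compAddMonoidHom_apply, this, AddChar.map_zero_eq_one]
  -- The character `φ` is given by its restrictions `θ` to `H` and evaluation at `a` to the dual.
  let θ : AddChar H ℂ := φ.compAddMonoidHom (AddMonoidHom.inl H (AddChar H ℂ))
  obtain ⟨a, ha⟩ := AddChar.doubleDualEmb_bijective.2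
    (φ.compAddMonoidHom (AddMonoidHom.inr H (AddChar H ℂ)))
  have hφ : ∀ w : H × AddChar H ℂ, φ w = θ w.1 * w.2 a := by
    intro w
    have h1 : w.2 a = φ (0, w.2) := by
      have := DFunLike.congr_fun ha w.2
      simpa using this
    have h2 : θ w.1 = φ (w.1, 0) := rfl
    rw [h1, h2, ← AddChar.map_add_eq_mul]
    simp
  have horth : ∀ w, Orth w (-a, θ) ↔ φ w = 1 := by
    intro w
    unfold Orth
    rw [hφ, AddChar.map_neg_eq_inv, mul_eq_one_iff_eq_inv₀ (addChar_ne_zero _ _), eq_comm]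
  exact hψ ((horth v).1 (h _ fun t ht => (horth t).2 (hφT t ht)).symm)

/-- `P` is stabilized by an isotropic subgroup `S` of the phase space. For a stabilizer code, `S`
consists of the points whose Weyl operators are stabilizers up to a phase. The Weyl operators of
`S` act on the code as scalars, and those of points orthogonal to `S` preserve the code. -/
structure IsStabilizedBy (P : Matrix H H ℂ) (S : AddSubgroup (H × AddChar H ℂ)) : Prop where
  isotropic : ∀ s ∈ S, ∀ t ∈ S, Orth s t
  scalar : ∀ s ∈ S, ∃ z : ℂ, weyl s * P = z • P
  commute : ∀ v, (∀ s ∈ S, Orth s v) → weyl v * P = P * weyl v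

/-- If `F` is a subgroup of the phase space, the logical operators commuting with the logical Weyl
operators of points orthogonal to `F` are spanned by the logical Weyl operators of points of `F`. -/
theorem IsStabilizedBy.eq_sum_of_commute {P : Matrix H H ℂ} {S : AddSubgroup (H × AddChar H ℂ)}
    (hS : IsStabilizedBy P S) (F : AddSubgroup (H × AddChar H ℂ)) {X : Matrix H H ℂ}
    (hl : P * X = X) (hr : X * P = X)
    (hX : ∀ w, (∀ s ∈ S, Orth s w) → (∀ f ∈ F, Orth f w) → weyl w * X = X * weyl w) :
    ∃ (z : H × AddChar H ℂ → ℂ) (f : H × AddChar H ℂ → H × AddChar H ℂ),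
      (∀ v, f v ∈ F) ∧ (∀ v, ∀ s ∈ S, Orth s (f v)) ∧ X = ∑ v, z v • (P * weyl (f v)) := by
  have hscal : ∀ s ∈ S, ∃ z : ℂ, P * weyl s = z • P := fun s hs => by
    rw [← hS.commute s fun t ht => hS.isotropic t ht s hs]
    exact hS.scalar s hs
  have hXS : ∀ s ∈ S, weyl s * X = X * weyl s := by
    intro s hs
    obtain ⟨z, hz⟩ := hS.scalar s hs
    have hz' : P * weyl s = z • P := by
      rw [← hS.commute s fun t ht => hS.isotropic t ht s hs, hz]
    calc weyl s * X = (weyl s * P) * X := by rw [mul_assoc, hl]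
      _ = X * (P * weyl s) := by
          rw [hz, hz', Matrix.smul_mul, hl, Matrix.mul_smul, hr]
      _ = X * weyl s := by rw [← mul_assoc, hr]
  have key : ∀ v, ∃ (z : ℂ) (f : H × AddChar H ℂ), f ∈ F ∧ (∀ s ∈ S, Orth s f) ∧
      ((Fintype.card H : ℂ)⁻¹ * ((weyl v)ᴴ * X).trace) • (P * weyl v) = z • (P * weyl f) := by
    intro v
    by_cases h0 : ((weyl v)ᴴ * X).trace = 0
    · exact ⟨0, 0, F.zero_mem, fun s _ => orth_zero s, by rw [h0, mul_zero, zero_smul, zero_smul]⟩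
    · -- A point `v` occurring in `X` is orthogonal to all points orthogonal to both `S` and `F`.
      -- By double annihilation it is `s + f`, and `s` acts on the code as a scalar.
      have hvS : ∀ s ∈ S, Orth s v := fun s hs => orth_of_trace_ne_zero (hXS s hs) h0
      have hv : v ∈ S ⊔ F := by
        refine mem_of_orth_orth _ _ fun w hw => orth_of_trace_ne_zero (hX w ?_ ?_) h0
        · exact fun s hs => hw s (AddSubgroup.mem_sup_left hs)
        · exact fun f hf => hw f (AddSubgroup.mem_sup_right hf)
      obtain ⟨s, hs, f, hf, rfl⟩ := AddSubgroup.mem_sup.1 hv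
      obtain ⟨z, hz⟩ := hscal s hs
      refine ⟨(Fintype.card H : ℂ)⁻¹ * ((weyl (s + f))ᴴ * X).trace * (s.2 f.1)⁻¹ * z, f, hf, ?_, ?_⟩
      · intro t ht
        have := (hvS t ht).sub (hS.isotropic t ht s hs)
        rwa [add_sub_cancel_left] at this
      · have hw : weyl (s + f) = (s.2 f.1)⁻¹ • (weyl s * weyl f) := by
          rw [weyl_mul, smul_smul, inv_mul_cancel₀ (addChar_ne_zero _ _), one_smul]
        rw [show P * weyl (s + f) = (s.2 f.1)⁻¹ • z • (P * weyl f) by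
          rw [hw, Matrix.mul_smul, ← mul_assoc, hz, Matrix.smul_mul], smul_smul, smul_smul]
  choose z f hf hfS hzf using key
  refine ⟨z, f, hf, hfS, ?_⟩
  conv_lhs => rw [← hl, eq_sum_weyl X, Finset.mul_sum]
  refine Finset.sum_congr rfl fun v _ => ?_
  rw [Matrix.mul_smul, hzf]

end Weyl

/-! ### Bipartite stabilizer codes -/

section Bipartite

variable {K L : Type*} [AddCommGroup K] [Fintype K] [DecidableEq K]
  [AddCommGroup L] [Fintype L] [DecidableEq L]

/-- The first factor of a Weyl operator of a product group. -/
def weylA (v : (K × L) × AddChar (K × L) ℂ) : Matrix K K ℂ :=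
  weyl (v.1.1, v.2.compAddMonoidHom (AddMonoidHom.inl K L))

/-- The second factor of a Weyl operator of a product group. -/
def weylB (v : (K × L) × AddChar (K × L) ℂ) : Matrix L L ℂ :=
  weyl (v.1.2, v.2.compAddMonoidHom (AddMonoidHom.inr K L))

theorem weyl_eq_kronecker (v : (K × L) × AddChar (K × L) ℂ) :
    weyl v = weylA v ⊗ₖ weylB v := by
  ext ⟨x, x'⟩ ⟨y, y'⟩
  simp only [weylA, weylB, Matrix.kronecker_apply, weyl_apply, AddChar.compAddMonoidHom_apply,
    AddMonoidHom.inl_apply, AddMonoidHom.inr_apply]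
  have h : v.2 (y, y') = v.2 (y, 0) * v.2 (0, y') := by
    rw [← AddChar.map_add_eq_mul]
    simp
  by_cases h1 : x = y + v.1.1
  · by_cases h2 : x' = y' + v.1.2
    · rw [if_pos h1, if_pos h2, if_pos (Prod.ext h1 h2), h]
    · rw [if_neg h2, if_neg fun h' => h2 (congrArg Prod.snd h'), mul_zero]
  · rw [if_neg h1, if_neg fun h' => h1 (congrArg Prod.fst h'), zero_mul]

/-- The points of the phase space whose Weyl operators act on the second factor only. -/
def phaseB (K L : Type*) [AddCommGroup K] [AddCommGroup L] :
    AddSubgroup ((K × L) × AddChar (K × L) ℂ) where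
  carrier := {v | v.1.1 = 0 ∧ ∀ x, v.2 (x, 0) = 1}
  zero_mem' := ⟨rfl, fun x => by simp⟩
  add_mem' := by
    rintro v w ⟨h1, h2⟩ ⟨h1', h2'⟩
    refine ⟨?_, fun x => ?_⟩
    · rw [Prod.fst_add, Prod.fst_add, h1, h1', add_zero]
    · rw [Prod.snd_add, AddChar.add_apply, h2, h2', one_mul]
  neg_mem' := by
    rintro v ⟨h1, h2⟩
    refine ⟨?_, fun x => ?_⟩
    · rw [Prod.fst_neg, Prod.fst_neg, h1, neg_zero]
    · rw [Prod.snd_neg, AddChar.neg_apply', h2, inv_one]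

theorem weylA_eq_one {v : (K × L) × AddChar (K × L) ℂ} (hv : v ∈ phaseB K L) : weylA v = 1 := by
  ext x y
  simp only [weylA, weyl_apply, Matrix.one_apply, hv.1, add_zero,
    AddChar.compAddMonoidHom_apply, AddMonoidHom.inl_apply, hv.2]

theorem weylB_eq_one {w : (K × L) × AddChar (K × L) ℂ} (hw : ∀ f ∈ phaseB K L, Orth f w) :
    weylB w = 1 := by
  have h1 : w.1.2 = 0 := by
    rw [← AddChar.forall_apply_eq_zero]
    intro ψ
    have := hw (0, ψ.compAddMonoidHom (AddMonoidHom.snd K L)) ⟨rfl, fun x => by simp⟩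
    unfold Orth at this
    simpa using this
  have h2 : ∀ y, w.2 (0, y) = 1 := by
    intro y
    have := hw ((0, y), 0) ⟨rfl, fun x => by simp⟩
    unfold Orth at this
    simpa using this.symm
  ext x y
  simp only [weylB, weyl_apply, Matrix.one_apply, h1, add_zero,
    AddChar.compAddMonoidHom_apply, AddMonoidHom.inr_apply, h2]

end Bipartite

section Codes

variable {a b : Type*} [Fintype a] [DecidableEq a] [Fintype b] [DecidableEq b]

/-- The two properties of a code that make its area operator exist and be trivial: the commutant of
`M_A` is contained in `M_Ā`, and the commutant of the local symmetries is scalar. -/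
structure IsLocallyHomogeneous (P : Matrix (a × b) (a × b) ℂ) : Prop where
  herm : Pᴴ = P
  idem : P * P = P
  mem_of_commute : ∀ Y, P * Y = Y → Y * P = Y →
    (∀ X ∈ codeSubalgebraA P, X * Y = Y * X) → Y ∈ codeSubalgebraB P
  eq_smul_of_commute : ∀ Y, P * Y = Y → Y * P = Y → (∀ UA UB, IsLocalSymmetry P UA UB →
    (UA ⊗ₖ UB) * Y = Y * (UA ⊗ₖ UB)) → ∃ z : ℂ, Y = z • P

theorem IsLocallyHomogeneous.conj {P : Matrix (a × b) (a × b) ℂ} (h : IsLocallyHomogeneous P)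
    {QA : Matrix a a ℂ} {QB : Matrix b b ℂ} (hA : QAᴴ * QA = 1) (hB : QBᴴ * QB = 1) :
    IsLocallyHomogeneous ((QA ⊗ₖ QB) * P * (QA ⊗ₖ QB)ᴴ) := by
  have hA' := mul_eq_one_comm.1 hA
  have hB' := mul_eq_one_comm.1 hB
  have hV1 : (QA ⊗ₖ QB)ᴴ * (QA ⊗ₖ QB) = 1 := by
    rw [Matrix.conjTranspose_kronecker, ← Matrix.mul_kronecker_mul, hA, hB,
      Matrix.one_kronecker_one]
  have hV2 := mul_eq_one_comm.1 hV1
  set V := QA ⊗ₖ QB with hV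
  set P' := V * P * Vᴴ with hP'
  have hmul : ∀ X Y, (V * X * Vᴴ) * (V * Y * Vᴴ) = V * (X * Y) * Vᴴ := by
    intro X Y
    calc _ = V * X * (Vᴴ * V) * Y * Vᴴ := by simp only [mul_assoc]
      _ = _ := by rw [hV1, mul_one]; simp only [mul_assoc]
  have hback : ∀ X, Vᴴ * (V * X * Vᴴ) * V = X := fun X => by
    calc Vᴴ * (V * X * Vᴴ) * V = (Vᴴ * V) * X * (Vᴴ * V) := by simp only [mul_assoc]
      _ = X := by rw [hV1, one_mul, mul_one]
  have hinj : ∀ X Y, V * X * Vᴴ = V * Y * Vᴴ → X = Y := fun X Y hXY => by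
    rw [← hback X, hXY, hback]
  have hsurj : ∀ Y, ∃ X, Y = V * X * Vᴴ := fun Y => ⟨Vᴴ * Y * V, by
    calc Y = (V * Vᴴ) * Y * (V * Vᴴ) := by rw [hV2, one_mul, mul_one]
      _ = _ := by simp only [mul_assoc]⟩
  have hherm : P'ᴴ = P' := by
    rw [hP', Matrix.conjTranspose_mul, Matrix.conjTranspose_mul,
      Matrix.conjTranspose_conjTranspose, h.herm, mul_assoc]
  refine ⟨hherm, by rw [hP', hmul, h.idem], ?_, ?_⟩
  · intro Y hl hr hY
    obtain ⟨Y, rfl⟩ := hsurj Y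
    refine conj_mem_codeSubalgebraB h.herm hherm hA' rfl hV1 (h.mem_of_commute _ ?_ ?_ ?_)
    · exact hinj _ _ (by rw [← hmul, ← hP', hl])
    · exact hinj _ _ (by rw [← hmul, ← hP', hr])
    · intro X hX
      refine hinj _ _ ?_
      rw [← hmul, ← hmul]
      exact hY _ (conj_mem_codeSubalgebraA h.herm hherm hB' rfl hV1 hX)
  · intro Y hl hr hY
    obtain ⟨Y, rfl⟩ := hsurj Y
    obtain ⟨z, hz⟩ := h.eq_smul_of_commute Y
      (hinj _ _ (by rw [← hmul, ← hP', hl])) (hinj _ _ (by rw [← hmul, ← hP', hr])) (by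
        intro UA UB hU
        refine hinj _ _ ?_
        rw [← hmul, ← hmul]
        have hk : V * (UA ⊗ₖ UB) * Vᴴ = (QA * UA * QAᴴ) ⊗ₖ (QB * UB * QBᴴ) := by
          rw [hV, Matrix.conjTranspose_kronecker, ← Matrix.mul_kronecker_mul,
            ← Matrix.mul_kronecker_mul]
        rw [hk]
        refine hY _ _ ⟨?_, ?_, ?_⟩
        · rw [Matrix.conjTranspose_mul, Matrix.conjTranspose_mul,
            Matrix.conjTranspose_conjTranspose]
          calc _ = QA * (UAᴴ * (QAᴴ * QA) * UA) * QAᴴ := by simp only [mul_assoc]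
            _ = 1 := by rw [hA, mul_one, hU.unitaryA, mul_one, hA']
        · rw [Matrix.conjTranspose_mul, Matrix.conjTranspose_mul,
            Matrix.conjTranspose_conjTranspose]
          calc _ = QB * (UBᴴ * (QBᴴ * QB) * UB) * QBᴴ := by simp only [mul_assoc]
            _ = 1 := by rw [hB, mul_one, hU.unitaryB, mul_one, hB']
        · rw [← hk, hP', hmul, hmul, hU.commute])
    exact ⟨z, by rw [hz, Matrix.mul_smul, Matrix.smul_mul]⟩

theorem IsLocallyHomogeneous.hasTrivialAreaOperator {P : Matrix (a × b) (a × b) ℂ}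
    (h : IsLocallyHomogeneous P) : HasTrivialAreaOperator P :=
  hasTrivialAreaOperator_of_symmetry h.herm h.idem h.mem_of_commute h.eq_smul_of_commute

/-- A bipartite stabilizer code is locally homogeneous: the Weyl operators on `H_A` orthogonal to
the stabilizers lie in `M_A`, and all Weyl operators orthogonal to the stabilizers are local
symmetries. -/
theorem IsStabilizedBy.isLocallyHomogeneous {K L : Type*} [AddCommGroup K] [Fintype K]
    [DecidableEq K] [AddCommGroup L] [Fintype L] [DecidableEq L]
    {P : Matrix (K × L) (K × L) ℂ} {S : AddSubgroup ((K × L) × AddChar (K × L) ℂ)}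
    (hS : IsStabilizedBy P S) (hP : Pᴴ = P) (hPi : P * P = P) : IsLocallyHomogeneous P := by
  refine ⟨hP, hPi, ?_, ?_⟩
  · intro Y hl hr hY
    -- Weyl operators orthogonal to those on `Ā` act on `A` only.
    obtain ⟨z, f, hf, hfS, hsum⟩ := hS.eq_sum_of_commute (phaseB K L) hl hr (by
      intro w hwS hwF
      have hc := hS.commute w hwS
      have hw : weyl w * P ∈ codeSubalgebraA P := by
        refine (mem_codeSubalgebraA_iff hP).2 ⟨weylA w, ?_, ?_⟩
        · rw [← weylB_eq_one hwF, ← weyl_eq_kronecker]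
        · rw [← weylB_eq_one hwF, ← weyl_eq_kronecker, hc]
      have := hY _ hw
      rwa [mul_assoc, hl, hc, ← mul_assoc, hr] at this)
    have hB : ∀ v, (1 : Matrix K K ℂ) ⊗ₖ weylB (f v) = weyl (f v) := fun v => by
      rw [weyl_eq_kronecker, weylA_eq_one (hf v)]
    rw [hsum]
    refine sum_mem_codeSubalgebraB fun v => (mem_codeSubalgebraB_iff hP).2
      ⟨z v • weylB (f v), ?_, ?_⟩
    · rw [Matrix.kronecker_smul, hB, Matrix.smul_mul, hS.commute _ (hfS v)]
    · rw [Matrix.kronecker_smul, hB, Matrix.mul_smul]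
  · intro Y hl hr hY
    obtain ⟨z, f, hf, -, hsum⟩ := hS.eq_sum_of_commute ⊥ hl hr (by
      intro w hwS _
      rw [weyl_eq_kronecker]
      refine hY _ _ ⟨conjTranspose_weyl_mul_self _, conjTranspose_weyl_mul_self _, ?_⟩
      rw [← weyl_eq_kronecker, hS.commute w hwS])
    refine ⟨∑ v, z v, ?_⟩
    rw [hsum, Finset.sum_smul]
    refine Finset.sum_congr rfl fun v _ => ?_
    rw [AddSubgroup.mem_bot.1 (hf v), weyl_zero, mul_one]

end Codes

/-! ### Stabilizer codes on qudits -/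

section Qudits

variable {G : Type*} [AddCommGroup G] [Fintype G] [DecidableEq G] {n : ℕ}

theorem bipartite_mul (A : Finset (Fin n)) (X Y : Matrix (Fin n → G) (Fin n → G) ℂ) :
    bipartite A (X * Y) = bipartite A X * bipartite A Y :=
  (Matrix.submatrix_mul_equiv X Y _ _ _).symm

theorem bipartite_conjTranspose (A : Finset (Fin n)) (X : Matrix (Fin n → G) (Fin n → G) ℂ) :
    bipartite A Xᴴ = (bipartite A X)ᴴ := rfl

theorem bipartite_one (A : Finset (Fin n)) :
    bipartite A (1 : Matrix (Fin n → G) (Fin n → G) ℂ) = 1 :=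
  Matrix.submatrix_one_equiv _

/-- A Pauli operator is a multiple of a Weyl operator for the bipartition. -/
theorem IsPauli.exists_eq_smul_weyl {X : Matrix (Fin n → G) (Fin n → G) ℂ} (hX : IsPauli X)
    (A : Finset (Fin n)) : ∃ (c : ℂ) (v : (({i // i ∈ A} → G) × ({i // i ∉ A} → G)) ×
      AddChar (({i // i ∈ A} → G) × ({i // i ∉ A} → G)) ℂ),
      c ≠ 0 ∧ bipartite A X = c • weyl v := by
  obtain ⟨c, s, χ, hc, rfl⟩ := hX
  set e := Equiv.piEquivPiSubtypeProd (fun i => i ∈ A) (fun _ : Fin n => G) with he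
  have hadd : ∀ x y, e (x + y) = e x + e y := fun x y => rfl
  have hadd' : ∀ x y, e.symm (x + y) = e.symm x + e.symm y := fun x y => by
    rw [Equiv.symm_apply_eq, hadd, Equiv.apply_symm_apply, Equiv.apply_symm_apply]
  have hzero : e.symm 0 = 0 := by rw [Equiv.symm_apply_eq]; rfl
  let θ : AddChar (({i // i ∈ A} → G) × ({i // i ∉ A} → G)) ℂ :=
    { toFun := fun y => ∏ i, χ i (e.symm y i)
      map_zero_eq_one' := by simp [hzero]
      map_add_eq_mul' := fun x y => by
        simp only [hadd', Pi.add_apply, AddChar.map_add_eq_mul, Finset.prod_mul_distrib] }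
  refine ⟨c, (e s, θ), fun h => by simp [h] at hc, ?_⟩
  ext x y
  have hL : bipartite A (Matrix.of fun x y => c * ∏ i, pauliSite (s i) (χ i) (x i) (y i)) x y
      = c * ∏ i, pauliSite (s i) (χ i) (e.symm x i) (e.symm y i) := rfl
  rw [hL, Matrix.smul_apply, smul_eq_mul, weyl_apply]
  congr 1
  simp only [pauliSite, Matrix.of_apply]
  by_cases h : x = y + e s
  · rw [if_pos h]
    refine Finset.prod_congr rfl fun i _ => if_pos ?_
    rw [h, hadd', Equiv.symm_apply_apply, Pi.add_apply]
  · rw [if_neg h]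
    obtain ⟨i, hi⟩ : ∃ i, e.symm x i ≠ e.symm y i + s i := by
      by_contra! hcon
      apply h
      rw [← e.apply_symm_apply x, ← e.apply_symm_apply y, ← hadd]
      exact congrArg e (funext hcon)
    exact Finset.prod_eq_zero (Finset.mem_univ i) (if_neg hi)

/-- An operator that commutes, together with its adjoint, with a family of operators commutes with
the orthogonal projector onto their common fixed space. -/
theorem commute_projector {c : Type*} [Fintype c] [DecidableEq c] {P T : Matrix c c ℂ}
    {𝒰 : Set (Matrix c c ℂ)} (hP : Pᴴ = P) (hPi : P * P = P)
    (hfix : ∀ v : c → ℂ, P *ᵥ v = v ↔ ∀ U ∈ 𝒰, U *ᵥ v = v)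
    (h1 : ∀ U ∈ 𝒰, U * T = T * U) (h2 : ∀ U ∈ 𝒰, U * Tᴴ = Tᴴ * U) : T * P = P * T := by
  have key : ∀ R : Matrix c c ℂ, (∀ U ∈ 𝒰, U * R = R * U) → P * (R * P) = R * P := by
    intro R hR
    refine Matrix.toLin'.injective (LinearMap.ext fun v => ?_)
    rw [Matrix.toLin'_apply, Matrix.toLin'_apply, ← Matrix.mulVec_mulVec, hfix]
    intro U hU
    rw [Matrix.mulVec_mulVec, ← mul_assoc, hR U hU, mul_assoc, ← Matrix.mulVec_mulVec,
      ← Matrix.mulVec_mulVec, ← Matrix.mulVec_mulVec]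
    congr 1
    refine (hfix _).1 ?_ U hU
    rw [Matrix.mulVec_mulVec, hPi]
  have e1 := key T h1
  have e2 := congrArg Matrix.conjTranspose (key Tᴴ h2)
  simp only [Matrix.conjTranspose_mul, Matrix.conjTranspose_conjTranspose, hP] at e2
  rw [← e1, ← mul_assoc, e2]

theorem IsStabilizerProjector.exists_isStabilizedBy {Pc : Matrix (Fin n → G) (Fin n → G) ℂ}
    (h : IsStabilizerProjector Pc) (A : Finset (Fin n)) :
    (bipartite A Pc)ᴴ = bipartite A Pc ∧ bipartite A Pc * bipartite A Pc = bipartite A Pc ∧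
      ∃ S, IsStabilizedBy (bipartite A Pc) S := by
  obtain ⟨S, hpauli, hab, hherm, hidem, hfix⟩ := h
  refine ⟨?_, ?_, ?_⟩
  · rw [← bipartite_conjTranspose, hherm.eq]
  · rw [← bipartite_mul, hidem]
  let T : AddSubgroup ((({i // i ∈ A} → G) × ({i // i ∉ A} → G)) ×
      AddChar (({i // i ∈ A} → G) × ({i // i ∉ A} → G)) ℂ) :=
    { carrier := {v | ∃ U ∈ S, ∃ c : ℂ, c ≠ 0 ∧ bipartite A U.1 = c • weyl v}
      zero_mem' := ⟨1, S.one_mem, 1, one_ne_zero, by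
        rw [weyl_zero, one_smul]
        exact bipartite_one A⟩
      add_mem' := by
        rintro v w ⟨U, hU, c, hc, h⟩ ⟨U', hU', c', hc', h'⟩
        refine ⟨U * U', S.mul_mem hU hU', c * c' * v.2 w.1,
          mul_ne_zero (mul_ne_zero hc hc') (addChar_ne_zero _ _), ?_⟩
        have : bipartite A (U * U').1 = bipartite A U.1 * bipartite A U'.1 := bipartite_mul A _ _
        rw [this, h, h', Matrix.smul_mul, Matrix.mul_smul, weyl_mul, smul_smul, smul_smul]
      neg_mem' := by
        rintro v ⟨U, hU, c, hc, h⟩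
        refine ⟨U⁻¹, S.inv_mem hU, star c * v.2 v.1,
          mul_ne_zero (star_ne_zero.2 hc) (addChar_ne_zero _ _), ?_⟩
        have : bipartite A (U⁻¹).1 = (bipartite A U.1)ᴴ := rfl
        rw [this, h, Matrix.conjTranspose_smul, conjTranspose_weyl, smul_smul] }
  refine ⟨T, ?_, ?_, ?_⟩
  · rintro v ⟨U, hU, c, hc, h⟩ w ⟨U', hU', c', hc', h'⟩
    have e : bipartite A U.1 * bipartite A U'.1 = bipartite A U'.1 * bipartite A U.1 := by
      rw [← bipartite_mul, ← bipartite_mul]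
      exact congrArg (fun W => bipartite A W.1) (hab U hU U' hU')
    rw [h, h', Matrix.smul_mul, Matrix.mul_smul, Matrix.smul_mul, Matrix.mul_smul, weyl_mul,
      weyl_mul, smul_smul, smul_smul, smul_smul, smul_smul, add_comm w v] at e
    have e' := smul_left_injective ℂ (weyl_ne_zero (v + w)) e
    rw [mul_comm c' c] at e'
    exact mul_left_cancel₀ (mul_ne_zero hc hc') (by simpa only [mul_assoc] using e')
  · rintro v ⟨U, hU, c, hc, h⟩
    have hUP : U.1 * Pc = Pc := by
      refine Matrix.toLin'.injective (LinearMap.ext fun x => ?_)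
      rw [Matrix.toLin'_apply, Matrix.toLin'_apply, ← Matrix.mulVec_mulVec]
      exact (hfix _).1 (by rw [Matrix.mulVec_mulVec, hidem]) U hU
    refine ⟨c⁻¹, ?_⟩
    rw [show weyl v = c⁻¹ • bipartite A U.1 by
      rw [h, smul_smul, inv_mul_cancel₀ hc, one_smul], Matrix.smul_mul, ← bipartite_mul, hUP]
  · intro v hv
    obtain ⟨R, hR⟩ := (bipartite A).surjective (weyl v)
    have hcomm : ∀ U ∈ S, weyl v * bipartite A U.1 = bipartite A U.1 * weyl v := by
      intro U hU
      obtain ⟨c, w, hc, hw⟩ := (hpauli U hU).exists_eq_smul_weyl A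
      rw [hw, Matrix.smul_mul, Matrix.mul_smul,
        (hv w ⟨U, hU, c, hc, hw⟩).weyl_commute]
    have hcomm' : ∀ U ∈ S, (weyl v)ᴴ * bipartite A U.1 = bipartite A U.1 * (weyl v)ᴴ := by
      intro U hU
      calc (weyl v)ᴴ * bipartite A U.1
          = (weyl v)ᴴ * (bipartite A U.1 * weyl v) * (weyl v)ᴴ := by
            rw [mul_assoc, mul_assoc, weyl_mul_conjTranspose_self, mul_one]
        _ = ((weyl v)ᴴ * weyl v) * bipartite A U.1 * (weyl v)ᴴ := by
            rw [← hcomm U hU]; simp only [mul_assoc]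
        _ = _ := by rw [conjTranspose_weyl_mul_self, one_mul]
    have := commute_projector (T := R) (𝒰 := {W | ∃ U ∈ S, U.1 = W}) hherm hidem
      (fun x => by rw [hfix]; simp)
      (by
        rintro _ ⟨U, hU, rfl⟩
        apply (bipartite A).injective
        rw [bipartite_mul, bipartite_mul, hR, hcomm U hU])
      (by
        rintro _ ⟨U, hU, rfl⟩
        apply (bipartite A).injective
        rw [bipartite_mul, bipartite_mul, bipartite_conjTranspose, hR, hcomm' U hU])
    rw [← hR, ← bipartite_mul, this, bipartite_mul]

end Qudits

end AreaLaw

theorem mainTheorem3 {G : Type*} [AddCommGroup G] [Fintype G] [DecidableEq G] (n : ℕ)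
    (A : Finset (Fin n))
    (Pc P : Matrix (Fin n → G) (Fin n → G) ℂ)
    (hPc : AreaLaw.IsStabilizerProjector Pc)
    (QA : Matrix.unitaryGroup ({i // i ∈ A} → G) ℂ)
    (QB : Matrix.unitaryGroup ({i // i ∉ A} → G) ℂ)
    (Q : Matrix (Fin n → G) (Fin n → G) ℂ)
    (hQ : AreaLaw.bipartite A Q = QA.1 ⊗ₖ QB.1)
    (hP : P = Q * Pc * Qᴴ) :
    AreaLaw.HasTrivialAreaOperator (AreaLaw.bipartite A P) := by
  obtain ⟨hherm, hidem, S, hS⟩ := hPc.exists_isStabilizedBy A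
  have h := (hS.isLocallyHomogeneous hherm hidem).conj (QA := QA.1) (QB := QB.1)
    (Matrix.mem_unitaryGroup_iff'.1 QA.2) (Matrix.mem_unitaryGroup_iff'.1 QB.2)
  rw [hP, AreaLaw.bipartite_mul, AreaLaw.bipartite_mul, AreaLaw.bipartite_conjTranspose, hQ]
  exact h.hasTrivialAreaOperator
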